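/- For a finite graph $G=(V,E)$ let $I(G;X)=\sum_{A} X^{|A|}$ be the independent set polynomial, where $A$ runs over all independent subsets of $V$. Let $x_0\in\mathbb{Q}$ with $x_0>-\tfrac14$ and $x_0\neq 0$. Suppose that there is a deterministic algorithm which, given an arbitrary $n$-vertex graph $G$, computes the rational number $I(G;x_0)$ (as a fraction of integers) in time $2^{o(n/\log^3 n)}$. Then there is a deterministic algorithm which, given an arbitrary $n$-vertex graph $G$, computes all coefficients of the polynomial $I(G;X)$ in time $2^{o(n)}$; in particular, for every $x_1\in\mathbb{Q}$ the value $I(G;x_1)$ can be computed in time $2^{o(n)}$. The same holds if "in time $2^{o(g(n))}$" is read throughout as "for every $c>0$ there is an algorithm (which may depend on $c$) running in time $O(2^{c\,g(n)})$", that is, as the negation of "requires time $2^{\Omega(g(n))}$". Graphs are given by their adjacency matrices, and time is measured in a standard deterministic model with integer operations charged by bit length (polynomially equivalent to Turing machines). -/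

import Mathlib

/-! ## A machine model with a step count

Deterministic while-programs over finitely many variables. A variable holds an integer or a
binary tree with integers at the leaves. Tree operations (pairing, projections, copying a
reference) have unit cost, integer arithmetic is charged by the bit lengths of its operands
(logarithmic cost). The model is polynomially equivalent to multitape Turing machines and to
logarithmic-cost random access machines, and running times `2 ^ o(g)` with `g` growing faster
than `log n` do not depend on the choice between polynomially equivalent models. -/

namespace WhileProg

/-- Values: integers and ordered pairs of values. -/
inductive Val : Type
  | int (z : ℤ) : Val
  | pair (a b : Val) : Val

namespace Val

/-- The integer at a leaf; `0` on a pair. -/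
def toInt : Val → ℤ
  | int z => z
  | pair _ _ => 0

/-- First component; the integer `0` on a leaf. -/
def fst : Val → Val
  | int _ => int 0
  | pair a _ => a

/-- Second component; the integer `0` on a leaf. -/
def snd : Val → Val
  | int _ => int 0
  | pair _ b => b

/-- `1` on a pair and `0` on a leaf. -/
def isPair : Val → ℤ
  | int _ => 0
  | pair _ _ => 1

/-- Lists as values: the empty list is the leaf `0`, and `a :: l` is the pair of `a` and `l`. -/
def ofList : List Val → Val
  | [] => int 0
  | a :: l => pair a (ofList l)

end Val

/-- Length of the signed binary representation of an integer. -/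
def bitLength (z : ℤ) : ℕ := Nat.size z.natAbs + 1

/-- The arithmetic instructions. -/
inductive Op : Type
  | add : Op
  | sub : Op
  | mul : Op
  | div : Op
  | le : Op

/-- Meaning of the arithmetic instructions; `div` is integer division with remainder (with value
`0` for the divisor `0`), and `le` returns `1` for true and `0` for false. -/
def Op.apply : Op → ℤ → ℤ → ℤ
  | .add, a, b => a + b
  | .sub, a, b => a - b
  | .mul, a, b => a * b
  | .div, a, b => a / b
  | .le, a, b => if a ≤ b then 1 else 0

/-- The contents of the variables. A program mentions only finitely many of them. -/
abbrev Store : Type := ℕ → Val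

/-- Expressions. -/
inductive Exp : Type
  | var (i : ℕ) : Exp
  | lit (z : ℤ) : Exp
  | pair (a b : Exp) : Exp
  | fst (a : Exp) : Exp
  | snd (a : Exp) : Exp
  | isPair (a : Exp) : Exp
  | op (o : Op) (a b : Exp) : Exp

/-- Value of an expression. -/
def Exp.eval (s : Store) : Exp → Val
  | .var i => s i
  | .lit z => .int z
  | .pair a b => .pair (a.eval s) (b.eval s)
  | .fst a => (a.eval s).fst
  | .snd a => (a.eval s).snd
  | .isPair a => .int (a.eval s).isPair
  | .op o a b => .int (o.apply (a.eval s).toInt (b.eval s).toInt)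

/-- Time for evaluating an expression. -/
def Exp.cost (s : Store) : Exp → ℕ
  | .var _ => 1
  | .lit z => 1 + bitLength z
  | .pair a b => a.cost s + b.cost s + 1
  | .fst a => a.cost s + 1
  | .snd a => a.cost s + 1
  | .isPair a => a.cost s + 1
  | .op _ a b =>
      a.cost s + b.cost s + 1 + bitLength (a.eval s).toInt + bitLength (b.eval s).toInt

/-- Programs. -/
inductive Prog : Type
  | skip : Prog
  | assign (i : ℕ) (e : Exp) : Prog
  | seq (p q : Prog) : Prog
  | cond (e : Exp) (p q : Prog) : Prog
  | loop (e : Exp) (p : Prog) : Prog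

/-- `Run p s s' t`: started on the store `s`, the program `p` halts with the store `s'` after
time exactly `t`. A test succeeds iff its value is not the integer `0`; `loop e p` repeats `p`
as long as the test `e` succeeds. -/
inductive Run : Prog → Store → Store → ℕ → Prop
  | skip (s : Store) : Run .skip s s 1
  | assign (i : ℕ) (e : Exp) (s : Store) :
      Run (.assign i e) s (Function.update s i (e.eval s)) (e.cost s + 1)
  | seq {p q : Prog} {s s' s'' : Store} {t t' : ℕ} :
      Run p s s' t → Run q s' s'' t' → Run (.seq p q) s s'' (t + t')
  | cond_true {e : Exp} {p q : Prog} {s s' : Store} {t : ℕ} :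
      e.eval s ≠ .int 0 → Run p s s' t → Run (.cond e p q) s s' (e.cost s + 1 + t)
  | cond_false {e : Exp} {p q : Prog} {s s' : Store} {t : ℕ} :
      e.eval s = .int 0 → Run q s s' t → Run (.cond e p q) s s' (e.cost s + 1 + t)
  | loop_true {e : Exp} {p : Prog} {s s' s'' : Store} {t t' : ℕ} :
      e.eval s ≠ .int 0 → Run p s s' t → Run (.loop e p) s' s'' t' →
      Run (.loop e p) s s'' (e.cost s + 1 + t + t')
  | loop_false {e : Exp} {p : Prog} {s : Store} :
      e.eval s = .int 0 → Run (.loop e p) s s (e.cost s + 1)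

/-- The initial store: the input is in variable `0`, all other variables hold `0`. -/
def initStore (input : Val) : Store := Function.update (fun _ => Val.int 0) 0 input

/-- On the given input, `p` halts within time `T`, and its output (the final content of
variable `0`) satisfies `post`. -/
def HaltsWithin (p : Prog) (input : Val) (post : Val → Prop) (T : ℝ) : Prop :=
  ∃ (s : Store) (t : ℕ), Run p (initStore input) s t ∧ post (s 0) ∧ (t : ℝ) ≤ T

end WhileProg

/-! ## Independent set polynomial and the computational problems -/

namespace IndepSetPoly

open WhileProg

open Classical in
/-- The independent set polynomial `I(G; X)`, the sum of `X ^ |A|` over all independent sets. -/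
noncomputable def indepPoly {V : Type*} [Fintype V] (G : SimpleGraph V) : Polynomial ℤ :=
  ∑ A ∈ Finset.univ.filter (fun A : Finset V => G.IsIndepSet (A : Set V)),
    Polynomial.X ^ Finset.card A

/-- Nondegenerate for path reduction. -/
def Nondegenerate (x : ℝ) : Prop := -1 / 4 < x ∧ x ≠ 0

open Classical in
/-- A graph with vertices `0, …, n - 1` as an input: the number `n` paired with the adjacency
matrix, given as the list of its rows. -/
noncomputable def encodeGraph {n : ℕ} (G : SimpleGraph (Fin n)) : Val :=
  .pair (.int n) (Val.ofList (List.ofFn fun i : Fin n =>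
    Val.ofList (List.ofFn fun j : Fin n => .int (if G.Adj i j then 1 else 0))))

/-- A computational problem on graphs: which outputs are correct for which input graph. -/
abbrev GraphProblem : Type := ∀ n : ℕ, SimpleGraph (Fin n) → Val → Prop

/-- Evaluate `I(G; x)`: the output has to be a fraction `a / b` of integers with this value. -/
def evaluation (x : ℚ) : GraphProblem := fun _ G v =>
  ∃ a b : ℤ, v = .pair (.int a) (.int b) ∧ 0 < b ∧
    (a : ℚ) / (b : ℚ) = Polynomial.aeval x (indepPoly G)

/-- Compute the coefficients of `X ^ 0, …, X ^ n` in `I(G; X)`, for a graph on `n` vertices. -/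
def coefficients : GraphProblem := fun n G v =>
  v = Val.ofList (List.ofFn fun k : Fin (n + 1) => .int ((indepPoly G).coeff k))

/-- A single program solves the problem, in time at most `T n` on all `n`-vertex graphs. -/
def SolvableInTime (Q : GraphProblem) (T : ℕ → ℝ) : Prop :=
  ∃ p : Prog, ∀ (n : ℕ) (G : SimpleGraph (Fin n)), HaltsWithin p (encodeGraph G) (Q n G) (T n)

/-- Solvable in time `2 ^ o(g(n))`, by one algorithm. -/
def SolvableInTwoPowLittleO (Q : GraphProblem) (g : ℕ → ℝ) : Prop :=
  ∃ f : ℕ → ℝ, f =o[Filter.atTop] g ∧ SolvableInTime Q (fun n => (2 : ℝ) ^ f n)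

/-- Solvable in time `O(2 ^ (c g(n)))` for every `c > 0`, by an algorithm that may depend on `c`:
the negation of "requires time `2 ^ Ω(g(n))`". -/
def SolvableInTwoPowEveryRate (Q : GraphProblem) (g : ℕ → ℝ) : Prop :=
  ∀ c : ℝ, 0 < c → ∃ C : ℝ, SolvableInTime Q (fun n => C * (2 : ℝ) ^ (c * g n))

end IndepSetPoly

/-! An evaluation oracle at one rational point `x₀ > -1`, `x₀ ≠ 0`, determines the whole
independent set polynomial of a graph `G` on `n` vertices: attach a gadget to every vertex.

If the same rooted tree is attached to every vertex of `G` (the root being the vertex itself), then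
an independent set of the new graph is an independent set `S` of `G` together with, for every
vertex, an independent set of the tree that contains the root or avoids it, according to whether the
vertex is in `S`. So the value at `x₀` of the new polynomial is `q ^ n * I(G; p / q)`, where `p` and
`q` are the weights of the independent sets of the tree that contain, respectively avoid, the root
(`aeval_gadgetGraph`). The trees used are caterpillars made of `m` units of constant size, and
every unit comes in two versions: one leaf is attached, or left as an isolated vertex, which only
multiplies both weights by `1 + x₀`. So there are `2 ^ m` gadgets of size `O(m)`. A unit acts on the
vector `(q, p)` by a matrix. With the right number of leaves per unit, the two matrices map a
suitable set of directions into disjoint parts of itself, so that the `2 ^ m` ratios `p / q` are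
distinct (`exists_leaves`). With `m = O(log n)` there are `n + 1` of them, and Lagrange
interpolation recovers `I(G; x₁)` for every `x₁` (`homogeneous_lagrange`). The coefficients are
the binary digits, in blocks, of the value at `2 ^ (n + 1)` (`eval_ediv_emod`).

The gadget graphs have `N = O(n log n)` vertices, hence `N / log ^ 3 N = O(n / log ^ 2 n) = o(n)`
(`eventually_gadgetSize_le`): the oracle calls take time `2 ^ o(n)`, already if the oracle is a
single program of rate `1`. It remains to see that all the rest is polynomial in the time of an
oracle call. The predicate `PT` says that a function is computed by a program in time polynomial in
a size parameter; it is closed under arithmetic, pairing, bounded iteration, sums, products, list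
formation, list access (`PT.iterate`, `PT.sum`, `PT.tabulate`, `PT.lookup`) and calls of the oracle
(`PT.oracle`), so that programs never have to be written out. Sums and products are recomputed
whenever they are used, which is wasteful, but only polynomially so. -/

namespace WhileProg

/-! ### Runs of programs: locality and growth -/

/-- Strict upper bound for the variables occurring in an expression. -/
def Exp.bound : Exp → ℕ
  | .var i => i + 1
  | .lit _ => 0
  | .pair a b => max a.bound b.bound
  | .fst a => a.bound
  | .snd a => a.bound
  | .isPair a => a.bound
  | .op _ a b => max a.bound b.bound

/-- Strict upper bound for the variables occurring in a program. -/
def Prog.bound : Prog → ℕ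
  | .skip => 0
  | .assign i e => max (i + 1) e.bound
  | .seq p q => max p.bound q.bound
  | .cond e p q => max e.bound (max p.bound q.bound)
  | .loop e p => max e.bound p.bound

theorem Run.frame {p : Prog} {s s' : Store} {t : ℕ} (h : Run p s s' t) :
    ∀ i, p.bound ≤ i → s' i = s i := by
  induction h with
  | skip s => intro i _; rfl
  | assign j e s =>
    intro i hi
    have : i ≠ j := by simp only [Prog.bound] at hi; omega
    simp [Function.update_of_ne this]
  | seq _ _ ih1 ih2 =>
    intro i hi
    simp only [Prog.bound, max_le_iff] at hi
    rw [ih2 i hi.2, ih1 i hi.1]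
  | cond_true _ _ ih =>
    intro i hi
    simp only [Prog.bound, max_le_iff] at hi
    exact ih i hi.2.1
  | cond_false _ _ ih =>
    intro i hi
    simp only [Prog.bound, max_le_iff] at hi
    exact ih i hi.2.2
  | loop_true _ _ _ ih1 ih2 =>
    intro i hi
    have hi' := hi
    simp only [Prog.bound, max_le_iff] at hi'
    rw [ih2 i hi, ih1 i hi'.2]
  | loop_false _ => intro i _; rfl

theorem Exp.eval_congr {s s' : Store} (e : Exp) (h : ∀ i < e.bound, s i = s' i) :
    e.eval s = e.eval s' := by
  induction e with
  | var i => exact h i (Nat.lt_succ_self i)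
  | lit z => rfl
  | pair a b iha ihb | op o a b iha ihb =>
    simp only [Exp.bound, lt_max_iff] at h
    simp only [Exp.eval, iha fun i hi => h i (Or.inl hi), ihb fun i hi => h i (Or.inr hi)]
  | fst a ih | snd a ih | isPair a ih => simp only [Exp.eval, ih h]

theorem Exp.cost_congr {s s' : Store} (e : Exp) (h : ∀ i < e.bound, s i = s' i) :
    e.cost s = e.cost s' := by
  induction e with
  | var i => rfl
  | lit z => rfl
  | pair a b iha ihb =>
    simp only [Exp.bound, lt_max_iff] at h
    simp only [Exp.cost, iha fun i hi => h i (Or.inl hi), ihb fun i hi => h i (Or.inr hi)]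
  | op o a b iha ihb =>
    simp only [Exp.bound, lt_max_iff] at h
    simp only [Exp.cost, iha fun i hi => h i (Or.inl hi), ihb fun i hi => h i (Or.inr hi),
      a.eval_congr fun i hi => h i (Or.inl hi), b.eval_congr fun i hi => h i (Or.inr hi)]
  | fst a ih | snd a ih | isPair a ih => simp only [Exp.cost, ih h]

/-- A run depends only on the variables that occur in the program. -/
theorem Run.congr {p : Prog} {s s' : Store} {t : ℕ} (h : Run p s s' t) {k : ℕ} :
    p.bound ≤ k → ∀ r : Store, (∀ i < k, s i = r i) →
      ∃ r', Run p r r' t ∧ ∀ i < k, s' i = r' i := by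
  induction h with
  | skip s => exact fun _ r hr => ⟨r, .skip r, hr⟩
  | assign j e s =>
    intro hk r hr
    simp only [Prog.bound, max_le_iff] at hk
    have he : ∀ i < e.bound, s i = r i := fun i hi => hr i (hi.trans_le hk.2)
    refine ⟨Function.update r j (e.eval r), by rw [e.cost_congr he]; exact .assign j e r,
      fun i hi => ?_⟩
    rw [e.eval_congr he]
    rcases eq_or_ne i j with rfl | hij
    · simp
    · simp [Function.update_of_ne hij, hr i hi]
  | seq _ _ ih1 ih2 =>
    intro hk r hr
    simp only [Prog.bound, max_le_iff] at hk
    obtain ⟨r1, h1, hr1⟩ := ih1 hk.1 r hr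
    obtain ⟨r2, h2, hr2⟩ := ih2 hk.2 r1 hr1
    exact ⟨r2, .seq h1 h2, hr2⟩
  | @cond_true e _ _ s _ _ he _ ih =>
    intro hk r hr
    simp only [Prog.bound, max_le_iff] at hk
    have hs : ∀ i < e.bound, s i = r i := fun i hi => hr i (hi.trans_le hk.1)
    obtain ⟨r1, h1, hr1⟩ := ih hk.2.1 r hr
    exact ⟨r1, e.cost_congr hs ▸ .cond_true (e.eval_congr hs ▸ he) h1, hr1⟩
  | @cond_false e _ _ s _ _ he _ ih =>
    intro hk r hr
    simp only [Prog.bound, max_le_iff] at hk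
    have hs : ∀ i < e.bound, s i = r i := fun i hi => hr i (hi.trans_le hk.1)
    obtain ⟨r1, h1, hr1⟩ := ih hk.2.2 r hr
    exact ⟨r1, e.cost_congr hs ▸ .cond_false (e.eval_congr hs ▸ he) h1, hr1⟩
  | @loop_true e _ s _ _ _ _ he _ _ ih1 ih2 =>
    intro hk r hr
    have hk' := hk
    simp only [Prog.bound, max_le_iff] at hk'
    have hs : ∀ i < e.bound, s i = r i := fun i hi => hr i (hi.trans_le hk'.1)
    obtain ⟨r1, h1, hr1⟩ := ih1 hk'.2 r hr
    obtain ⟨r2, h2, hr2⟩ := ih2 hk r1 hr1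
    exact ⟨r2, e.cost_congr hs ▸ .loop_true (e.eval_congr hs ▸ he) h1 h2, hr2⟩
  | @loop_false e _ s he =>
    intro hk r hr
    simp only [Prog.bound, max_le_iff] at hk
    have hs : ∀ i < e.bound, s i = r i := fun i hi => hr i (hi.trans_le hk.1)
    exact ⟨r, e.cost_congr hs ▸ .loop_false (e.eval_congr hs ▸ he), hr⟩

/-- The largest bit length of an integer at a leaf. -/
def Val.bits : Val → ℕ
  | .int z => bitLength z
  | .pair a b => max a.bits b.bits

theorem bitLength_le_iff {z : ℤ} {k : ℕ} : bitLength z ≤ k + 1 ↔ z.natAbs < 2 ^ k := by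
  simp [bitLength, Nat.size_le]

theorem one_le_bitLength (z : ℤ) : 1 ≤ bitLength z := Nat.le_add_left 1 _

theorem bitLength_le_of_natAbs_le {a b : ℤ} (h : a.natAbs ≤ b.natAbs) :
    bitLength a ≤ bitLength b := Nat.succ_le_succ (Nat.size_le_size h)

theorem bitLength_add_le (a b : ℤ) : bitLength (a + b) ≤ max (bitLength a) (bitLength b) + 1 := by
  rw [bitLength_le_iff]
  obtain ⟨k, hk⟩ : ∃ k, max (bitLength a) (bitLength b) = k + 1 :=
    ⟨max (bitLength a) (bitLength b) - 1, by have := one_le_bitLength a; omega⟩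
  have ha : a.natAbs < 2 ^ k := bitLength_le_iff.1 (hk ▸ le_max_left _ _)
  have hb : b.natAbs < 2 ^ k := bitLength_le_iff.1 (hk ▸ le_max_right _ _)
  have := Int.natAbs_add_le a b
  rw [hk, pow_succ]
  omega

theorem bitLength_mul_le (a b : ℤ) : bitLength (a * b) ≤ bitLength a + bitLength b := by
  have h : bitLength a + bitLength b = (a.natAbs.size + b.natAbs.size + 1) + 1 := by
    simp only [bitLength]; omega
  rw [h, bitLength_le_iff, Int.natAbs_mul, pow_succ, pow_add]
  have := Nat.mul_lt_mul'' (Nat.lt_size_self a.natAbs) (Nat.lt_size_self b.natAbs)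
  omega

theorem bitLength_apply_le (o : Op) (a b : ℤ) :
    bitLength (o.apply a b) ≤ bitLength a + bitLength b := by
  have ha := one_le_bitLength a
  have hb := one_le_bitLength b
  cases o with
  | add => have := bitLength_add_le a b; simp only [Op.apply]; omega
  | sub =>
    have h1 := bitLength_add_le a (-b)
    have h2 : bitLength (-b) = bitLength b := by simp [bitLength]
    simp only [Op.apply, sub_eq_add_neg]; omega
  | mul => exact bitLength_mul_le a b
  | div =>
    have := bitLength_le_of_natAbs_le (Int.natAbs_ediv_le_natAbs a b)
    simp only [Op.apply]; omega
  | le =>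
    have h1 : bitLength 1 = 2 := by decide +kernel
    have h0 : bitLength 0 = 1 := by decide +kernel
    simp only [Op.apply]; split_ifs <;> omega

theorem Val.one_le_bits (v : Val) : 1 ≤ v.bits := by
  induction v with
  | int z => exact one_le_bitLength z
  | pair a b iha _ => exact le_max_of_le_left iha

theorem Val.bits_fst_le (v : Val) : v.fst.bits ≤ v.bits := by
  cases v with
  | int z => exact one_le_bitLength z
  | pair a b => exact le_max_left _ _

theorem Val.bits_snd_le (v : Val) : v.snd.bits ≤ v.bits := by
  cases v with
  | int z => exact one_le_bitLength z
  | pair a b => exact le_max_right _ _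

theorem Exp.bits_eval_le {s : Store} {B : ℕ} (hB : ∀ i, (s i).bits ≤ B) (e : Exp) :
    (e.eval s).bits ≤ B + e.cost s := by
  induction e with
  | var i => exact (hB i).trans (Nat.le_add_right _ _)
  | lit z => simp only [Exp.eval, Val.bits, Exp.cost]; omega
  | pair a b iha ihb => simp only [Exp.eval, Val.bits, Exp.cost]; omega
  | fst a ih => have := (a.eval s).bits_fst_le; simp only [Exp.eval, Exp.cost]; omega
  | snd a ih => have := (a.eval s).bits_snd_le; simp only [Exp.eval, Exp.cost]; omega
  | isPair a ih =>
    have h := (hB 0).trans' (s 0).one_le_bits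
    have h1 : bitLength 1 = 2 := by decide +kernel
    have h0 : bitLength 0 = 1 := by decide +kernel
    simp only [Exp.eval, Exp.cost, Val.bits]
    cases a.eval s <;> simp only [Val.isPair] <;> omega
  | op o a b iha ihb =>
    have := bitLength_apply_le o (a.eval s).toInt (b.eval s).toInt
    simp only [Exp.eval, Exp.cost, Val.bits]; omega

/-- In `t` steps the bit lengths grow by at most `t`. -/
theorem Run.bits_le {p : Prog} {s s' : Store} {t : ℕ} (h : Run p s s' t) :
    ∀ {B : ℕ}, (∀ i, (s i).bits ≤ B) → ∀ i, (s' i).bits ≤ B + t := by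
  induction h with
  | skip s => exact fun hB i => (hB i).trans (Nat.le_add_right _ _)
  | assign j e s =>
    intro B hB i
    rcases eq_or_ne i j with rfl | hij
    · have := e.bits_eval_le hB
      simp only [Function.update_self]; omega
    · simp only [Function.update_of_ne hij]
      exact (hB i).trans (Nat.le_add_right _ _)
  | seq _ _ ih1 ih2 => intro B hB i; have := ih2 (ih1 hB) i; omega
  | cond_true _ _ ih | cond_false _ _ ih => intro B hB i; have := ih hB i; omega
  | loop_true _ _ _ ih1 ih2 => intro B hB i; have := ih2 (ih1 hB) i; omega
  | loop_false _ => exact fun hB i => (hB i).trans (Nat.le_add_right _ _)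

end WhileProg

namespace WhileProg

/-! ### Polynomially bounded functions -/

/-- `f` is bounded by a polynomial in the size parameter `μ`. -/
def PolyBdd {ι : Type} (μ f : ι → ℕ) : Prop := ∃ c : ℕ, ∀ x, f x ≤ (μ x + 2) ^ c

namespace PolyBdd

variable {ι κ : Type} {μ f g : ι → ℕ}

theorem mono (hg : PolyBdd μ g) (h : ∀ x, f x ≤ g x) : PolyBdd μ f :=
  hg.imp fun _ hc x => (h x).trans (hc x)

theorem const (k : ℕ) : PolyBdd μ fun _ => k :=
  ⟨k, fun _ => k.lt_two_pow_self.le.trans (Nat.pow_le_pow_left (by omega) k)⟩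

theorem self : PolyBdd μ μ := ⟨1, fun x => by simp⟩

theorem mul (hf : PolyBdd μ f) (hg : PolyBdd μ g) : PolyBdd μ fun x => f x * g x := by
  obtain ⟨c, hc⟩ := hf
  obtain ⟨d, hd⟩ := hg
  exact ⟨c + d, fun x => by rw [pow_add]; exact Nat.mul_le_mul (hc x) (hd x)⟩

theorem max (hf : PolyBdd μ f) (hg : PolyBdd μ g) : PolyBdd μ fun x => max (f x) (g x) := by
  obtain ⟨c, hc⟩ := hf
  obtain ⟨d, hd⟩ := hg
  refine ⟨Max.max c d, fun x => max_le ((hc x).trans ?_) ((hd x).trans ?_)⟩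
  · exact Nat.pow_le_pow_right (by omega) (le_max_left _ _)
  · exact Nat.pow_le_pow_right (by omega) (le_max_right _ _)

theorem add (hf : PolyBdd μ f) (hg : PolyBdd μ g) : PolyBdd μ fun x => f x + g x :=
  ((const 2).mul (hf.max hg)).mono fun x => by omega

theorem comap (hf : PolyBdd μ f) (π : κ → ι) : PolyBdd (fun y => μ (π y)) fun y => f (π y) :=
  hf.imp fun _ hc y => hc (π y)

end PolyBdd

/-! ### Functions computed in polynomial time -/

/-- `f` is computed, from inputs encoded by `e`, by a single program whose running time is bounded
by a polynomial in the size parameter `μ`, and so are the bit lengths of the integers in `f x`.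
The input and the output are in variable `0`; the other variables may hold anything initially.

The index type `ι` restricts the inputs to the meaningful ones, and `μ` is independent of the
encoding `e`: a large `μ` leaves room for calls of an expensive subroutine. -/
def PT {ι : Type} (e : ι → Val) (μ : ι → ℕ) (f : ι → Val) : Prop :=
  (∃ (p : Prog) (T : ι → ℕ), PolyBdd μ T ∧ ∀ x (s : Store), s 0 = e x →
    ∃ s' t, Run p s s' t ∧ s' 0 = f x ∧ t ≤ T x) ∧ PolyBdd μ fun x => (f x).bits

/-- The encodings of pairs consisting of `x : ι` and a number below `k x`. -/
def ext {ι : Type} (e : ι → Val) (k : ι → ℕ) : (Σ x, Fin (k x)) → Val :=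
  fun y => .pair (e y.1) (.int (y.2 : ℕ))

namespace PT

variable {ι κ : Type} {e : ι → Val} {μ : ι → ℕ} {f g : ι → Val} {k : ι → ℕ}

theorem congr (hf : PT e μ f) (h : ∀ x, g x = f x) : PT e μ g := by
  rwa [show g = f from funext h]

/-- Composition: `f` is applied to an input that is itself computed. -/
theorem comp {e' : κ → Val} {μ' : κ → ℕ} (hf : PT e μ f) (π : κ → ι)
    (hπ : PT e' μ' fun y => e (π y)) (hμ : ∀ y, μ (π y) ≤ μ' y) : PT e' μ' fun y => f (π y) := by
  obtain ⟨⟨p, T, ⟨c, hc⟩, hp⟩, ⟨d, hd⟩⟩ := hf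
  obtain ⟨⟨q, U, hU, hq⟩, -⟩ := hπ
  have hm : ∀ m y, (μ (π y) + 2) ^ m ≤ (μ' y + 2) ^ m := fun m y =>
    Nat.pow_le_pow_left (Nat.add_le_add_right (hμ y) 2) m
  have hT : PolyBdd μ' fun y => T (π y) := ⟨c, fun y => (hc _).trans (hm c y)⟩
  refine ⟨⟨.seq q p, fun y => U y + T (π y), hU.add hT, fun y s hs => ?_⟩,
    ⟨d, fun y => (hd _).trans (hm d y)⟩⟩
  obtain ⟨s1, t1, r1, h1, b1⟩ := hq y s hs
  obtain ⟨s2, t2, r2, h2, b2⟩ := hp (π y) s1 h1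
  exact ⟨s2, _, .seq r1 r2, h2, Nat.add_le_add b1 b2⟩

/-- An expression in the value of `f`, whose evaluation costs at most a polynomial. -/
theorem exp (hf : PT e μ f) (E : Exp) {C : ι → ℕ} (hC : PolyBdd μ C)
    (hE : ∀ x (s : Store), s 0 = f x → E.eval s = g x ∧ E.cost s ≤ C x)
    (hb : PolyBdd μ fun x => (g x).bits) : PT e μ g := by
  obtain ⟨⟨p, T, hT, hp⟩, -⟩ := hf
  refine ⟨⟨.seq p (.assign 0 E), fun x => T x + (C x + 1), hT.add (hC.add (.const 1)),
    fun x s hs => ?_⟩, hb⟩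
  obtain ⟨s1, t1, r1, h1, b1⟩ := hp x s hs
  obtain ⟨hv, hc⟩ := hE x s1 h1
  exact ⟨_, _, .seq r1 (.assign 0 E s1), by simpa using hv,
    Nat.add_le_add b1 (Nat.succ_le_succ hc)⟩

theorem fst (hf : PT e μ f) : PT e μ fun x => (f x).fst :=
  hf.exp (.fst (.var 0)) (.const 2) (fun x s hs => by simp [Exp.eval, Exp.cost, hs])
    (hf.2.mono fun x => (f x).bits_fst_le)

theorem snd (hf : PT e μ f) : PT e μ fun x => (f x).snd :=
  hf.exp (.snd (.var 0)) (.const 2) (fun x s hs => by simp [Exp.eval, Exp.cost, hs])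
    (hf.2.mono fun x => (f x).bits_snd_le)

theorem id (hb : PolyBdd μ fun x => (e x).bits) : PT e μ e :=
  ⟨⟨.skip, fun _ => 1, .const 1, fun _ s hs => ⟨s, 1, .skip s, hs, le_rfl⟩⟩, hb⟩

theorem pair (hf : PT e μ f) (hg : PT e μ g) : PT e μ fun x => .pair (f x) (g x) := by
  obtain ⟨⟨p, T, hT, hp⟩, hfb⟩ := hf
  obtain ⟨⟨q, U, hU, hq⟩, hgb⟩ := hg
  -- The input is kept in variable `K` and the value of `f` in variable `K + 1`.
  set K := max p.bound q.bound + 1 with hK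
  refine ⟨⟨.seq (.assign K (.var 0)) (.seq p (.seq (.assign (K + 1) (.var 0))
    (.seq (.assign 0 (.var K)) (.seq q (.assign 0 (.pair (.var (K + 1)) (.var 0))))))),
    fun x => T x + (U x + 12), hT.add (hU.add (.const 12)), fun x s hs => ?_⟩, hfb.max hgb⟩
  obtain ⟨s1, t1, r1, h1, b1⟩ := hp x (Function.update s K (s 0)) (by
    rw [Function.update_of_ne (by omega), hs])
  have k1 : s1 K = e x := by rw [r1.frame K (by omega), Function.update_self, hs]
  set s2 := Function.update s1 (K + 1) (s1 0) with hs2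
  set s3 := Function.update s2 0 (s2 K) with hs3
  obtain ⟨s4, t4, r4, h4, b4⟩ := hq x s3 (by
    rw [hs3, Function.update_self, hs2, Function.update_of_ne (by omega), k1])
  have k4 : s4 (K + 1) = f x := by
    rw [r4.frame _ (by omega), hs3, Function.update_of_ne (by omega), hs2, Function.update_self, h1]
  refine ⟨_, _, .seq (.assign K (.var 0) s) (.seq r1 (.seq (.assign (K + 1) (.var 0) s1)
    (.seq (.assign 0 (.var K) s2) (.seq r4 (.assign 0 (.pair (.var (K + 1)) (.var 0)) s4))))),
    ?_, ?_⟩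
  · simp [Exp.eval, k4, h4]
  · simp only [Exp.cost]; omega

theorem const (z : ℤ) : PT e μ fun _ => .int z :=
  ⟨⟨.assign 0 (.lit z), fun _ => 1 + bitLength z + 1, .const _, fun _ s _ =>
    ⟨_, _, .assign 0 (.lit z) s, by simp [Exp.eval], by simp [Exp.cost]⟩⟩, .const (bitLength z)⟩

theorem op (o : Op) {a b : ι → ℤ} (ha : PT e μ fun x => .int (a x))
    (hb : PT e μ fun x => .int (b x)) : PT e μ fun x => .int (o.apply (a x) (b x)) := by
  have h : PolyBdd μ fun x => bitLength (a x) + bitLength (b x) := ha.2.add hb.2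
  refine (ha.pair hb).exp (.op o (.fst (.var 0)) (.snd (.var 0))) (h.add (.const 5))
    (fun x s hs => ?_) (h.mono fun x => bitLength_apply_le o _ _)
  simp only [Exp.eval, Exp.cost, hs, Val.fst, Val.snd, Val.toInt, true_and]
  omega

theorem add {a b : ι → ℤ} (ha : PT e μ fun x => .int (a x)) (hb : PT e μ fun x => .int (b x)) :
    PT e μ fun x => .int (a x + b x) := op .add ha hb

theorem sub {a b : ι → ℤ} (ha : PT e μ fun x => .int (a x)) (hb : PT e μ fun x => .int (b x)) :
    PT e μ fun x => .int (a x - b x) := op .sub ha hb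

theorem mul {a b : ι → ℤ} (ha : PT e μ fun x => .int (a x)) (hb : PT e μ fun x => .int (b x)) :
    PT e μ fun x => .int (a x * b x) := op .mul ha hb

theorem div {a b : ι → ℤ} (ha : PT e μ fun x => .int (a x)) (hb : PT e μ fun x => .int (b x)) :
    PT e μ fun x => .int (a x / b x) := op .div ha hb

/-- The repetition of a program `p` that works on a saved input (variable `K`), a counter
(variable `K + 1`) up to a limit (variable `K + 2`) and a state (variable `K + 3`); `m` is the
number of the remaining repetitions. -/
theorem run_loop {p : Prog} {K : ℕ} (hK : p.bound < K) {inp : Val} {n : ℕ} {st : ℕ → Val} {B : ℕ}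
    (hp : ∀ j < n, ∀ s : Store, s 0 = .pair inp (.pair (.int j) (st j)) →
      ∃ s' t, Run p s s' t ∧ s' 0 = st (j + 1) ∧ t ≤ B) :
    ∀ m ≤ n, ∀ s : Store, s K = inp → s (K + 1) = .int ((n - m : ℕ) : ℤ) → s (K + 2) = .int n →
      s (K + 3) = st (n - m) →
      ∃ s' t, Run (.loop (.op .sub (.var (K + 2)) (.var (K + 1)))
        (.seq (.assign 0 (.pair (.var K) (.pair (.var (K + 1)) (.var (K + 3)))))
          (.seq p (.seq (.assign (K + 3) (.var 0))
            (.assign (K + 1) (.op .add (.var (K + 1)) (.lit 1))))))) s s' t ∧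
        s' (K + 3) = st n ∧ t ≤ (m + 1) * (B + 3 * bitLength n + 30) := by
  have hlit : bitLength 1 = 2 := by decide +kernel
  have hbit : ∀ j ≤ n, bitLength (j : ℤ) ≤ bitLength (n : ℤ) := fun j hj =>
    bitLength_le_of_natAbs_le (by simpa using hj)
  intro m
  induction m with
  | zero =>
    intro _ s _ h1 h2 h3
    refine ⟨s, _, .loop_false ?_, by simpa using h3, ?_⟩
    · simp [Exp.eval, h1, h2, Val.toInt, Op.apply]
    · simp only [Exp.cost, Exp.eval, h1, h2, Val.toInt, Nat.sub_zero]; omega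
  | succ m ih =>
    intro hm s h0 h1 h2 h3
    obtain ⟨s2, t2, r2, v2, b2⟩ := hp (n - (m + 1)) (by omega) (Function.update s 0
      ((Exp.pair (.var K) (.pair (.var (K + 1)) (.var (K + 3)))).eval s)) (by
        simp [Exp.eval, h0, h1, h3])
    have fr : ∀ i, K ≤ i → s2 i = s i := fun i hi => by
      rw [r2.frame i (by omega), Function.update_of_ne (by omega)]
    set s3 := Function.update s2 (K + 3) (s2 0) with hs3
    have e3 : s3 (K + 1) = .int ((n - (m + 1) : ℕ) : ℤ) := by
      rw [hs3, Function.update_of_ne (by omega), fr _ (by omega), h1]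
    set s4 := Function.update s3 (K + 1)
      ((Exp.op .add (.var (K + 1)) (.lit 1)).eval s3) with hs4
    obtain ⟨s', t, r, hv, hb⟩ := ih (by omega) s4
      (by rw [hs4, Function.update_of_ne (by omega), hs3, Function.update_of_ne (by omega),
        fr _ le_rfl, h0])
      (by
        rw [hs4, Function.update_self]
        simp only [Exp.eval, e3, Val.toInt, Op.apply]
        congr 1; omega)
      (by rw [hs4, Function.update_of_ne (by omega), hs3, Function.update_of_ne (by omega),
        fr _ (by omega), h2])
      (by rw [hs4, Function.update_of_ne (by omega), hs3, Function.update_self, v2]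
          congr 1; omega)
    refine ⟨s', _, .loop_true ?_ (.seq (.assign _ _ s) (.seq r2 (.seq (.assign _ _ s2)
      (.assign _ _ s3)))) r, hv, ?_⟩
    · simp only [Exp.eval, h1, h2, Val.toInt, Op.apply, ne_eq, Val.int.injEq]; omega
    · have := hbit (n - (m + 1)) (by omega)
      simp only [Exp.cost, Exp.eval, h1, h2, e3, Val.toInt, hlit]
      rw [Nat.succ_mul (m + 1)]
      omega

/-- Bounded iteration: `st x j` is the state after `j` of the `k x` repetitions. The step sees the
input, the counter and the state; its time bound depends on `x` only, which includes a bound for the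
bit lengths of all states. -/
theorem iterate {st : ι → ℕ → Val} (h0 : PT e μ fun x => st x 0)
    (hk : PT e μ fun x => .int (k x : ℕ)) (hkb : PolyBdd μ k)
    (hs : PT (fun y : Σ x, Fin (k x) => .pair (e y.1) (.pair (.int (y.2 : ℕ)) (st y.1 y.2)))
      (fun y => μ y.1) fun y => st y.1 (y.2 + 1))
    (hb : PolyBdd μ fun x => (st x (k x)).bits) : PT e μ fun x => st x (k x) := by
  obtain ⟨⟨p, T, hT, hp⟩, -⟩ := h0
  obtain ⟨⟨q, U, hU, hq⟩, hkbits⟩ := hk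
  obtain ⟨⟨r, W, ⟨c, hc⟩, hr⟩, -⟩ := hs
  set K := Max.max p.bound (Max.max q.bound r.bound) + 1 with hK
  have hB : PolyBdd μ fun x => (μ x + 2) ^ c := ⟨c, fun _ => le_rfl⟩
  have hL : PolyBdd μ fun x =>
      T x + (U x + ((k x + 1) * ((μ x + 2) ^ c + 3 * bitLength (k x) + 30) + 30)) :=
    hT.add (hU.add (((hkb.add (.const 1)).mul ((hB.add ((PolyBdd.const 3).mul hkbits)).add
      (.const 30))).add (.const 30)))
  refine ⟨⟨.seq (.assign K (.var 0)) (.seq p (.seq (.assign (K + 3) (.var 0))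
    (.seq (.assign 0 (.var K)) (.seq q (.seq (.assign (K + 2) (.var 0))
    (.seq (.assign (K + 1) (.lit 0)) (.seq (.loop (.op .sub (.var (K + 2)) (.var (K + 1)))
        (.seq (.assign 0 (.pair (.var K) (.pair (.var (K + 1)) (.var (K + 3)))))
          (.seq r (.seq (.assign (K + 3) (.var 0))
            (.assign (K + 1) (.op .add (.var (K + 1)) (.lit 1)))))))
      (.assign 0 (.var (K + 3)))))))))), _, hL, fun x s hs => ?_⟩, hb⟩
  obtain ⟨s1, t1, r1, h1, b1⟩ := hp x (Function.update s K (s 0)) (by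
    rw [Function.update_of_ne (by omega), hs])
  have k1 : s1 K = e x := by rw [r1.frame K (by omega), Function.update_self, hs]
  set s2 := Function.update s1 (K + 3) (s1 0) with hs2
  set s3 := Function.update s2 0 (s2 K) with hs3
  obtain ⟨s4, t4, r4, h4, b4⟩ := hq x s3 (by
    rw [hs3, Function.update_self, hs2, Function.update_of_ne (by omega), k1])
  have fr : ∀ i, K ≤ i → s4 i = s2 i := fun i hi => by
    rw [r4.frame i (by omega), hs3, Function.update_of_ne (by omega)]
  set s5 := Function.update s4 (K + 2) (s4 0) with hs5
  set s6 := Function.update s5 (K + 1) (.int 0) with hs6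
  obtain ⟨s7, t7, r7, h7, b7⟩ := run_loop (p := r) (K := K) (by omega) (inp := e x) (n := k x)
    (st := st x) (B := (μ x + 2) ^ c) (fun j hj s hs => by
      obtain ⟨s', t, hrun, hv, ht⟩ := hr ⟨x, ⟨j, hj⟩⟩ s hs
      exact ⟨s', t, hrun, hv, ht.trans (hc _)⟩) (k x) le_rfl s6
    (by rw [hs6, Function.update_of_ne (by omega), hs5, Function.update_of_ne (by omega),
      fr _ le_rfl, hs2, Function.update_of_ne (by omega), k1])
    (by rw [hs6, Function.update_self]; simp)
    (by rw [hs6, Function.update_of_ne (by omega), hs5, Function.update_self, h4])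
    (by rw [hs6, Function.update_of_ne (by omega), hs5, Function.update_of_ne (by omega),
      fr _ (by omega), hs2, Function.update_self, h1, Nat.sub_self])
  refine ⟨_, _, .seq (.assign K (.var 0) s) (.seq r1 (.seq (.assign (K + 3) (.var 0) s1)
    (.seq (.assign 0 (.var K) s2) (.seq r4 (.seq (.assign (K + 2) (.var 0) s4)
    (.seq (.assign (K + 1) (.lit 0) s5) (.seq r7 (.assign 0 (.var (K + 3)) s7)))))))), ?_, ?_⟩
  · simp [Exp.eval, h7]
  · have h0 : bitLength 0 = 1 := by decide +kernel
    simp only [Exp.cost, h0]; omega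

end PT

end WhileProg

namespace WhileProg

namespace PT

variable {ι : Type} {e : ι → Val} {μ : ι → ℕ} {f : ι → Val} {k : ι → ℕ}

/-! ### Loops that compute sums, products and lists -/

theorem ext_self (he : PT e μ e) (hk : PolyBdd μ k) : PT (ext e k) (fun y => μ y.1) (ext e k) := by
  refine id (((he.2.comap Sigma.fst).add ((hk.comap Sigma.fst).add (.const 1))).mono fun y => ?_)
  have : bitLength (y.2 : ℕ) ≤ k y.1 + 1 := by
    rw [bitLength_le_iff, Int.natAbs_natCast]
    exact y.2.2.trans Nat.lt_two_pow_self
  simp only [ext, Val.bits]; omega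

theorem weaken (he : PT e μ e) (hk : PolyBdd μ k) (hf : PT e μ f) :
    PT (ext e k) (fun y => μ y.1) fun y => f y.1 :=
  hf.comp Sigma.fst (ext_self he hk).fst fun _ => le_rfl

theorem index (he : PT e μ e) (hk : PolyBdd μ k) :
    PT (ext e k) (fun y => μ y.1) fun y => .int (y.2 : ℕ) :=
  (ext_self he hk).snd

/-- The context in which the body of a loop is executed. -/
theorem loopCtx (he : PT e μ e) (hk : PolyBdd μ k) {st : ι → ℕ → Val}
    (hb : PolyBdd (fun y : Σ x, Fin (k x) => μ y.1) fun y => (st y.1 y.2).bits) :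
    PT (fun y : Σ x, Fin (k x) => .pair (e y.1) (.pair (.int (y.2 : ℕ)) (st y.1 y.2)))
      (fun y => μ y.1)
      (fun y => .pair (e y.1) (.pair (.int (y.2 : ℕ)) (st y.1 y.2))) := by
  refine id (((ext_self he hk).2.add hb).mono fun y => ?_)
  simp only [ext, Val.bits]; omega

/-- Bounded iteration whose body uses the input and the counter through `g` and combines the
result with the state by an operation `o`. -/
theorem iterate_op {o : Op} {z : ι → ℕ → ℤ} {a : (Σ x, Fin (k x)) → ℤ} (he : PT e μ e)
    (hk : PT e μ fun x => .int (k x : ℕ)) (hkb : PolyBdd μ k) (h0 : PT e μ fun x => .int (z x 0))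
    (ha : PT (ext e k) (fun y => μ y.1) fun y => .int (a y))
    (hs : ∀ y : Σ x, Fin (k x), z y.1 (y.2 + 1) = o.apply (z y.1 y.2) (a y))
    (hb : PolyBdd (fun y : Σ x, Fin (k x + 1) => μ y.1) fun y => bitLength (z y.1 y.2)) :
    PT e μ fun x => .int (z x (k x)) := by
  have hb' : PolyBdd (fun y : Σ x, Fin (k x) => μ y.1) fun y => (Val.int (z y.1 y.2)).bits :=
    hb.comap fun y : Σ x, Fin (k x) => ⟨y.1, y.2.castSucc⟩
  have hctx := loopCtx (st := fun x j => .int (z x j)) he hkb hb'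
  refine iterate (st := fun x j => .int (z x j)) h0 hk hkb ?_
    (hb.comap fun x => (⟨x, Fin.last (k x)⟩ : Σ x, Fin (k x + 1)))
  exact (op o (a := fun y : Σ x, Fin (k x) => z y.1 y.2) hctx.snd.snd
    (ha.comp (fun y => y) (hctx.fst.pair hctx.snd.fst) fun _ => le_rfl)).congr fun y => by rw [hs y]

theorem bitLength_sum_le {a : ℕ → ℤ} {B : ℕ} : ∀ {m : ℕ}, (∀ j < m, bitLength (a j) ≤ B) →
    bitLength (∑ j ∈ Finset.range m, a j) ≤ B + m + 1 := by
  intro m h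
  induction m with
  | zero => simp [bitLength]
  | succ m ih =>
    have h1 := ih fun j hj => h j (by omega)
    have h2 := h m (by omega)
    have h3 := bitLength_add_le (∑ j ∈ Finset.range m, a j) (a m)
    rw [Finset.sum_range_succ]; omega

theorem bitLength_prod_le {a : ℕ → ℤ} {B : ℕ} : ∀ {m : ℕ}, (∀ j < m, bitLength (a j) ≤ B) →
    bitLength (∏ j ∈ Finset.range m, a j) ≤ m * B + 2 := by
  intro m h
  induction m with
  | zero => simp [bitLength]
  | succ m ih =>
    have h1 := ih fun j hj => h j (by omega)
    have h2 := h m (by omega)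
    have h3 := bitLength_mul_le (∏ j ∈ Finset.range m, a j) (a m)
    rw [Finset.prod_range_succ, Nat.succ_mul]; omega

theorem sum {a : ι → ℕ → ℤ} (he : PT e μ e) (hk : PT e μ fun x => .int (k x : ℕ))
    (hkb : PolyBdd μ k) (ha : PT (ext e k) (fun y => μ y.1) fun y => .int (a y.1 y.2)) :
    PT e μ fun x => .int (∑ j ∈ Finset.range (k x), a x j) := by
  obtain ⟨c, hc⟩ := ha.2
  have hB : PolyBdd μ fun x => (μ x + 2) ^ c + k x + 1 :=
    ((show PolyBdd μ fun x => (μ x + 2) ^ c from ⟨c, fun _ => le_rfl⟩).add hkb).add (.const 1)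
  refine iterate_op (o := .add) (z := fun x m => ∑ j ∈ Finset.range m, a x j) he hk hkb
    ((const 0).congr fun x => by simp) ha (fun y => Finset.sum_range_succ _ _)
    ((hB.comap Sigma.fst).mono fun y => ?_)
  have h := bitLength_sum_le (a := a y.1) (B := (μ y.1 + 2) ^ c) (m := y.2) fun j hj =>
    hc ⟨y.1, j, by omega⟩
  exact h.trans (by have := y.2.2; omega)

theorem prod {a : ι → ℕ → ℤ} (he : PT e μ e) (hk : PT e μ fun x => .int (k x : ℕ))
    (hkb : PolyBdd μ k) (ha : PT (ext e k) (fun y => μ y.1) fun y => .int (a y.1 y.2)) :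
    PT e μ fun x => .int (∏ j ∈ Finset.range (k x), a x j) := by
  obtain ⟨c, hc⟩ := ha.2
  have hB : PolyBdd μ fun x => k x * (μ x + 2) ^ c + 2 :=
    (hkb.mul (show PolyBdd μ fun x => (μ x + 2) ^ c from ⟨c, fun _ => le_rfl⟩)).add (.const 2)
  refine iterate_op (o := .mul) (z := fun x m => ∏ j ∈ Finset.range m, a x j) he hk hkb
    ((const 1).congr fun x => by simp) ha (fun y => Finset.prod_range_succ _ _)
    ((hB.comap Sigma.fst).mono fun y => ?_)
  have h := bitLength_prod_le (a := a y.1) (B := (μ y.1 + 2) ^ c) (m := y.2) fun j hj =>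
    hc ⟨y.1, j, by omega⟩
  exact h.trans (Nat.add_le_add_right (Nat.mul_le_mul_right _ (by omega)) 2)

theorem pow {a : ι → ℤ} (he : PT e μ e) (ha : PT e μ fun x => .int (a x))
    (hk : PT e μ fun x => .int (k x : ℕ)) (hkb : PolyBdd μ k) :
    PT e μ fun x => .int (a x ^ k x) :=
  (prod (a := fun x _ => a x) he hk hkb (weaken he hkb ha)).congr fun x => by simp

end PT

theorem Val.bits_ofList_le {l : List Val} {B : ℕ} (hB : 1 ≤ B) (h : ∀ v ∈ l, v.bits ≤ B) :
    (Val.ofList l).bits ≤ B := by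
  induction l with
  | nil => exact hB
  | cons a l ih =>
    exact max_le (h a (by simp)) (ih fun v hv => h v (by simp [hv]))

theorem Val.bits_le_ofList {l : List Val} {v : Val} (h : v ∈ l) : v.bits ≤ (Val.ofList l).bits := by
  induction l with
  | nil => simp at h
  | cons a l ih =>
    rcases List.mem_cons.1 h with rfl | h
    · exact le_max_left _ _
    · exact le_max_of_le_right (ih h)

theorem Val.snd_ofList (l : List Val) : (Val.ofList l).snd = Val.ofList l.tail := by
  cases l <;> rfl

theorem Val.fst_ofList (l : List Val) : (Val.ofList l).fst = l.headD (.int 0) := by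
  cases l <;> rfl

namespace PT

variable {ι : Type} {e : ι → Val} {μ : ι → ℕ} {f : ι → Val} {k : ι → ℕ}

/-- Access to an entry of a list. -/
theorem lookup {l : ι → List Val} {i : ι → ℕ} (he : PT e μ e)
    (hl : PT e μ fun x => Val.ofList (l x)) (hi : PT e μ fun x => .int (i x : ℕ))
    (hib : PolyBdd μ i) : PT e μ fun x => (l x).getD (i x) (.int 0) := by
  have hle : ∀ x j, (Val.ofList ((l x).drop j)).bits ≤ (Val.ofList (l x)).bits := fun x j =>
    Val.bits_ofList_le (Val.one_le_bits _) fun v hv => Val.bits_le_ofList (List.mem_of_mem_drop hv)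
  have hb : PolyBdd (fun y : Σ x, Fin (i x) => μ y.1)
      fun y => (Val.ofList ((l y.1).drop y.2)).bits :=
    (hl.2.comap Sigma.fst).mono fun y => hle _ _
  have hctx := loopCtx (st := fun x j => Val.ofList ((l x).drop j)) he hib hb
  have h := iterate (st := fun x j => Val.ofList ((l x).drop j)) (hl.congr fun x => by simp) hi hib
    (hctx.snd.snd.snd.congr fun y => by
      change _ = (Val.ofList _).snd
      rw [Val.snd_ofList, List.tail_drop])
    (hl.2.mono fun x => hle x _)
  refine h.fst.congr fun x => ?_
  rw [Val.fst_ofList, List.headD_eq_head?_getD, List.head?_drop, List.getD_eq_getElem?_getD]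

/-- The list of the values of a function on `{0, …, k - 1}`, built from its end. -/
theorem tabulate {g : (Σ x, Fin (k x)) → Val} (he : PT e μ e)
    (hk : PT e μ fun x => .int (k x : ℕ)) (hkb : PolyBdd μ k)
    (hg : PT (ext e k) (fun y => μ y.1) g) :
    PT e μ fun x => Val.ofList (List.ofFn fun j => g ⟨x, j⟩) := by
  obtain ⟨c, hc⟩ := hg.2
  have hB : PolyBdd μ fun x => (μ x + 2) ^ c := ⟨c, fun _ => le_rfl⟩
  set st : ι → ℕ → Val := fun x m =>
    Val.ofList ((List.ofFn fun j => g ⟨x, j⟩).drop (k x - m)) with hst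
  have hle : ∀ x m, (st x m).bits ≤ (μ x + 2) ^ c := fun x m => by
    refine Val.bits_ofList_le (Nat.one_le_two_pow.trans (Nat.pow_le_pow_left (by omega) c))
      fun v hv => ?_
    obtain ⟨j, rfl⟩ := List.mem_ofFn.1 (List.mem_of_mem_drop hv)
    exact hc _
  have hctx := loopCtx (st := st) he hkb ((hB.comap Sigma.fst).mono fun y => hle _ _)
  have hrev := hg.comp (fun y : Σ x, Fin (k x) => (⟨y.1, y.2.rev⟩ : Σ x, Fin (k x)))
    (e' := fun y : Σ x, Fin (k x) => .pair (e y.1) (.pair (.int (y.2 : ℕ)) (st y.1 y.2)))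
    (μ' := fun y => μ y.1)
    ((hctx.fst.pair (((hk.comp Sigma.fst hctx.fst fun _ => le_rfl).sub
      (a := fun y : Σ x, Fin (k x) => (k y.1 : ℤ)) (b := fun y => ((y.2 : ℕ) : ℤ))
      hctx.snd.fst).sub (const 1))).congr fun y => by
        simp only [ext, Val.fst, Fin.val_rev]; congr 2; have := y.2.2; omega)
    fun _ => le_rfl
  have h := iterate (st := st) ((const 0).congr fun x => by
    simp only [hst, Nat.sub_zero]; rw [List.drop_of_length_le (by simp)]; rfl) hk hkb
    ((hrev.pair hctx.snd.snd).congr fun y => ?_) (hB.mono fun x => hle x _)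
  · exact h.congr fun x => by simp [hst]
  · have hy := y.2.2
    simp only [hst, Val.snd]
    rw [List.drop_eq_getElem_cons (i := k y.1 - (y.2 + 1)) (by rw [List.length_ofFn]; omega)]
    simp only [Val.ofList, List.getElem_ofFn]
    congr 4
    omega

/-! ### Decidable properties and arithmetic of natural numbers -/

theorem natAdd {a b : ι → ℕ} (ha : PT e μ fun x => .int (a x)) (hb : PT e μ fun x => .int (b x)) :
    PT e μ fun x => .int ((a x + b x : ℕ) : ℤ) := (ha.add hb).congr fun x => by simp

theorem natMul {a b : ι → ℕ} (ha : PT e μ fun x => .int (a x)) (hb : PT e μ fun x => .int (b x)) :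
    PT e μ fun x => .int ((a x * b x : ℕ) : ℤ) := (ha.mul hb).congr fun x => by simp

theorem natDiv {a b : ι → ℕ} (ha : PT e μ fun x => .int (a x)) (hb : PT e μ fun x => .int (b x)) :
    PT e μ fun x => .int ((a x / b x : ℕ) : ℤ) := (ha.div hb).congr fun x => by simp

theorem mod {a b : ι → ℤ} (ha : PT e μ fun x => .int (a x)) (hb : PT e μ fun x => .int (b x)) :
    PT e μ fun x => .int (a x % b x) :=
  (ha.sub (hb.mul (ha.div hb))).congr fun x => by rw [Int.emod_def]

theorem natMod {a b : ι → ℕ} (ha : PT e μ fun x => .int (a x)) (hb : PT e μ fun x => .int (b x)) :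
    PT e μ fun x => .int ((a x % b x : ℕ) : ℤ) := (ha.mod hb).congr fun x => by simp

end PT

open Classical in
/-- The property `P` is decided in polynomial time. -/
def PTP {ι : Type} (e : ι → Val) (μ : ι → ℕ) (P : ι → Prop) : Prop :=
  PT e μ fun x => .int (if P x then 1 else 0)

namespace PTP

variable {ι : Type} {e : ι → Val} {μ : ι → ℕ} {P Q : ι → Prop}

theorem congr (hP : PTP e μ P) (h : ∀ x, Q x ↔ P x) : PTP e μ Q := by
  rwa [show Q = P from funext fun x => propext (h x)]

theorem le {a b : ι → ℤ} (ha : PT e μ fun x => .int (a x)) (hb : PT e μ fun x => .int (b x)) :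
    PTP e μ fun x => a x ≤ b x :=
  (PT.op .le ha hb).congr fun x => by simp only [Op.apply]; congr

theorem not (hP : PTP e μ P) : PTP e μ fun x => ¬ P x :=
  ((PT.const 1).sub hP).congr fun x => by by_cases h : P x <;> simp [h]

theorem and (hP : PTP e μ P) (hQ : PTP e μ Q) : PTP e μ fun x => P x ∧ Q x :=
  (PT.mul hP hQ).congr fun x => by by_cases h : P x <;> by_cases h' : Q x <;> simp [h, h']

theorem or (hP : PTP e μ P) (hQ : PTP e μ Q) : PTP e μ fun x => P x ∨ Q x :=
  (hP.not.and hQ.not).not.congr fun x => by tauto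

theorem eq {a b : ι → ℤ} (ha : PT e μ fun x => .int (a x)) (hb : PT e μ fun x => .int (b x)) :
    PTP e μ fun x => a x = b x := ((le ha hb).and (le hb ha)).congr fun _ => le_antisymm_iff

theorem natEq {a b : ι → ℕ} (ha : PT e μ fun x => .int (a x)) (hb : PT e μ fun x => .int (b x)) :
    PTP e μ fun x => a x = b x := (eq ha hb).congr fun x => by simp

theorem natLe {a b : ι → ℕ} (ha : PT e μ fun x => .int (a x)) (hb : PT e μ fun x => .int (b x)) :
    PTP e μ fun x => a x ≤ b x := (le ha hb).congr fun x => by simp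

open Classical in
theorem ite {a b : ι → ℤ} (hP : PTP e μ P) (ha : PT e μ fun x => .int (a x))
    (hb : PT e μ fun x => .int (b x)) : PT e μ fun x => .int (if P x then a x else b x) :=
  ((PT.mul hP ha).add (PT.mul hP.not hb)).congr fun x => by by_cases h : P x <;> simp [h]

end PTP

/-! ### Calling a given program as a subroutine -/

/-- The program that sets the variables `1, …, k` to `0`. -/
def clear : ℕ → Prog
  | 0 => .skip
  | k + 1 => .seq (clear k) (.assign (k + 1) (.lit 0))

theorem run_clear (k : ℕ) (s : Store) :
    ∃ s', Run (clear k) s s' (3 * k + 1) ∧ s' 0 = s 0 ∧ ∀ i, 1 ≤ i → i ≤ k → s' i = .int 0 := by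
  induction k with
  | zero => exact ⟨s, .skip s, rfl, fun i h1 h2 => by omega⟩
  | succ k ih =>
    obtain ⟨s', h, h0, hc⟩ := ih
    refine ⟨Function.update s' (k + 1) (.int 0), ?_, by simpa using h0, fun i h1 h2 => ?_⟩
    · have : Exp.cost s' (.lit 0) + 1 = 3 := by simp [Exp.cost, bitLength]
      have := this ▸ Run.seq h (.assign (k + 1) (.lit 0) s')
      exact (show 3 * (k + 1) + 1 = 3 * k + 1 + 3 by ring) ▸ this
    rcases eq_or_ne i (k + 1) with rfl | hi
    · simp
    · rw [Function.update_of_ne hi]; exact hc i h1 (by omega)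

/-- If a program solves a problem within time `T` then some solution of the problem is computable
in any size parameter that polynomially bounds `T`. -/
theorem PT.oracle {Q : IndepSetPoly.GraphProblem} {T : ℕ → ℝ}
    (h : IndepSetPoly.SolvableInTime Q T) :
    ∃ F : ∀ n, SimpleGraph (Fin n) → Val, (∀ n G, Q n G (F n G)) ∧
      ∀ {ι : Type} {e : ι → Val} {μ : ι → ℕ} {N : ι → ℕ} {G : ∀ x, SimpleGraph (Fin (N x))},
        PT e μ (fun x => IndepSetPoly.encodeGraph (G x)) → PolyBdd μ (fun x => ⌈T (N x)⌉₊) →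
        PT e μ fun x => F (N x) (G x) := by
  obtain ⟨p, hp⟩ := h
  choose s t hr hQ ht using hp
  refine ⟨fun n G => s n G 0, hQ, fun {ι e μ N G} hG hT => ?_⟩
  have ht' : ∀ x, t (N x) (G x) ≤ ⌈T (N x)⌉₊ := fun x => by
    exact_mod_cast (ht (N x) (G x)).trans (Nat.le_ceil _)
  have hrun : PT (fun x => IndepSetPoly.encodeGraph (G x)) μ fun x => s (N x) (G x) 0 := by
    refine ⟨⟨.seq (clear p.bound) p, fun x => (3 * p.bound + 1) + ⌈T (N x)⌉₊,
      (PolyBdd.const _).add hT, fun x r hx => ?_⟩, (hG.2.add hT).mono fun x => ?_⟩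
    · obtain ⟨r1, h1, h0, hc⟩ := run_clear p.bound r
      obtain ⟨r2, h2, h3⟩ := (hr (N x) (G x)).congr (k := p.bound + 1) (Nat.le_succ _) r1
        fun i hi => by
          rcases Nat.eq_zero_or_pos i with rfl | hi0
          · simp [initStore, h0, hx]
          · rw [hc i hi0 (by omega), initStore, Function.update_of_ne (by omega)]
      exact ⟨r2, _, .seq h1 h2, (h3 0 (by omega)).symm, Nat.add_le_add_left (ht' x) _⟩
    · refine ((hr (N x) (G x)).bits_le (B := (IndepSetPoly.encodeGraph (G x)).bits)
        (fun i => ?_) 0).trans (Nat.add_le_add_left (ht' x) _)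
      rcases eq_or_ne i 0 with rfl | hi
      · simp [initStore]
      · rw [initStore, Function.update_of_ne hi]; exact Val.one_le_bits _
  exact hrun.comp (fun x => x) hG fun _ => le_rfl

end WhileProg

namespace IndepSetPoly

open Finset

/-! ### The independent set polynomial as a sum over configurations -/

/-- The characteristic functions of the independent sets of `G`. -/
def IsIndepConfig {V : Type*} (G : SimpleGraph V) (σ : V → Bool) : Prop :=
  ∀ p q, G.Adj p q → σ p = true → σ q = false

open Classical in
theorem aeval_indepPoly {V : Type*} [Fintype V] [DecidableEq V] (G : SimpleGraph V) (x : ℚ) :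
    Polynomial.aeval x (indepPoly G) =
      ∑ σ : V → Bool with IsIndepConfig G σ, ∏ p, if σ p then x else 1 := by
  rw [indepPoly, map_sum]
  refine Finset.sum_bij' (fun A _ p => decide (p ∈ A)) (fun σ _ => univ.filter fun p => σ p = true)
    ?_ ?_ ?_ ?_ ?_
  · intro A hA
    simp only [mem_filter, mem_univ, true_and] at hA ⊢
    simp only [IsIndepConfig, decide_eq_true_eq, decide_eq_false_iff_not]
    exact fun p q h hp hq => hA hp hq h.ne h
  · intro σ hσ
    simp only [mem_filter, mem_univ, true_and] at hσ ⊢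
    intro p hp q hq _ h
    simp only [coe_filter, mem_univ, true_and, Set.mem_ofPred_eq] at hp hq
    simp [hσ p q h hp] at hq
  · intro A _; ext p; simp
  · intro σ _; ext p; simp
  · intro A _
    simp

open Classical in
/-- The two-variable homogenization of the independent set polynomial. -/
theorem sum_config_eq {n : ℕ} (G : SimpleGraph (Fin n)) (a : ℚ) {b : ℚ} (hb : b ≠ 0) :
    ∑ S : Fin n → Bool with IsIndepConfig G S, ∏ v, (if S v then a else b) =
      b ^ n * Polynomial.aeval (a / b) (indepPoly G) := by
  rw [aeval_indepPoly, Finset.mul_sum]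
  refine Finset.sum_congr rfl fun S _ => ?_
  rw [← Fin.prod_const, ← Finset.prod_mul_distrib]
  refine Finset.prod_congr rfl fun v _ => ?_
  split_ifs
  · field_simp
  · simp

open Classical in
/-- A weighted count of families of configurations, grouped by the states of their roots. -/
theorem sum_prod_root {V C R : Type*} [Fintype V] [DecidableEq V] [Fintype C] [CommRing R]
    (P : (V → Bool) → Prop) (root : C → Bool) (g : C → R) :
    ∑ σ : V → C with P (fun v => root (σ v)), ∏ v, g (σ v) =
      ∑ S : V → Bool with P S, ∏ v, ∑ c with root c = S v, g c := by
  rw [← Finset.sum_fiberwise_of_maps_to (t := univ.filter P) (g := fun σ v => root (σ v))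
    (fun σ hσ => by simpa using hσ)]
  refine Finset.sum_congr rfl fun S hS => ?_
  rw [Finset.prod_univ_sum]
  refine Finset.sum_congr ?_ fun _ _ => rfl
  ext σ
  simp only [mem_filter, mem_univ, true_and, Fintype.mem_piFinset, funext_iff]
  constructor
  · exact fun h => h.2
  · intro h
    refine ⟨?_, h⟩
    rw [show (fun v => root (σ v)) = S from funext h]
    simpa using hS

/-! ### Transfer matrices of the gadgets -/

/-- Adjacency inside a unit of a caterpillar, from the spine vertex `0` to the others: the spine
vertex `1`, the leaves `3, 4, …`, and the vertex `2` if `β` holds; otherwise vertex `2` is isolated,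
so that both versions of a unit have the same number of vertices. -/
def UnitRel (β : Bool) (r : ℕ) : Prop := r = 1 ∨ 3 ≤ r ∨ (r = 2 ∧ β = true)

/-- The characteristic functions of the independent sets of a unit with `l + 3` vertices. -/
def UnitOK {l : ℕ} (β : Bool) (c : Fin (l + 3) → Bool) : Prop :=
  ∀ r : Fin (l + 3), UnitRel β r → c 0 = true → c r = false

/-- The characteristic functions of the independent sets of a caterpillar of `M` units: vertex `1`
of every unit is joined to vertex `0` of the next one. -/
def ChainOK {l M : ℕ} (b : ℕ → Bool) (σ : Fin M → Fin (l + 3) → Bool) : Prop :=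
  (∀ t : Fin M, UnitOK (b t) (σ t)) ∧
    ∀ t t' : Fin M, (t' : ℕ) = t + 1 → σ t 1 = true → σ t' 0 = false

/-- The state of the root of a caterpillar. -/
def top {l : ℕ} : ∀ {M : ℕ}, (Fin M → Fin (l + 3) → Bool) → Bool
  | 0, _ => false
  | _ + 1, σ => σ 0 0

/-- The weight of a configuration of a unit. -/
def unitWeight {l : ℕ} (x : ℚ) (c : Fin (l + 3) → Bool) : ℚ := ∏ r, if c r then x else 1

open Classical in
/-- Once the states of the two spine vertices are given, the other vertices are independent of each
other, and the sum is a product over the vertices. -/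
theorem sum_unit (l : ℕ) (x : ℚ) (β s s1 : Bool) :
    ∑ c : Fin (l + 3) → Bool with UnitOK β c ∧ c 0 = s ∧ c 1 = s1, unitWeight x c =
      if s then (if s1 then 0 else x * (if β then 1 else 1 + x))
      else (if s1 then x else 1) * (1 + x) ^ (l + 1) := by
  have h01 : (1 : Fin (l + 3)) ≠ 0 := by simp
  have h20 : (2 : Fin (l + 3)) ≠ 0 := Fin.ne_of_val_ne (by simp [Nat.mod_eq_of_lt])
  have h21 : (2 : Fin (l + 3)) ≠ 1 := Fin.ne_of_val_ne (by simp [Nat.mod_eq_of_lt])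
  have hset : (univ.filter fun c : Fin (l + 3) → Bool => UnitOK β c ∧ c 0 = s ∧ c 1 = s1) =
      Fintype.piFinset fun r : Fin (l + 3) => univ.filter fun y : Bool =>
        (r = 0 → y = s) ∧ (r = 1 → y = s1) ∧ (UnitRel β r → s = true → y = false) := by
    ext c
    simp only [mem_filter, mem_univ, true_and, Fintype.mem_piFinset]
    constructor
    · rintro ⟨h, rfl, rfl⟩ r
      exact ⟨fun h => h ▸ rfl, fun h => h ▸ rfl, h r⟩
    · intro h
      have h0 := (h 0).1 rfl
      exact ⟨fun r hr hc => (h r).2.2 hr (h0 ▸ hc), h0, (h 1).2.1 rfl⟩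
  simp only [hset, unitWeight]
  rw [← Finset.prod_univ_sum (f := fun _ y => if y = true then x else 1)]
  rw [Fin.prod_univ_succ, Fin.prod_univ_succ, Fin.prod_univ_succ]
  simp only [Finset.sum_filter, Fintype.sum_bool, UnitRel, Fin.val_succ, Fin.val_zero]
  have e1 : ((0 : Fin (l + 2)).succ : Fin (l + 3)) = 1 := rfl
  have e2 : ∀ i : Fin l, ¬ (i.succ.succ.succ : Fin (l + 3)) = 1 := fun i h => by
    simpa using congrArg Fin.val h
  cases s <;> cases s1 <;> cases β <;> simp [e1, e2, h01, h20, h21, Finset.sum_filter] <;>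
    ring_nf <;> simp

open Classical in
/-- The weighted number of independent sets of a caterpillar whose root has the state `s`. -/
noncomputable def chainSum (l : ℕ) (x : ℚ) (M : ℕ) (b : ℕ → Bool) (s : Bool) : ℚ :=
  ∑ σ : Fin M → Fin (l + 3) → Bool with ChainOK b σ ∧ top σ = s, ∏ t, unitWeight x (σ t)

theorem chainOK_cons {l M : ℕ} {b : ℕ → Bool} (c : Fin (l + 3) → Bool)
    (σ : Fin M → Fin (l + 3) → Bool) :
    ChainOK b (Fin.cons c σ : Fin (M + 1) → Fin (l + 3) → Bool) ↔
      UnitOK (b 0) c ∧ (c 1 = true → top σ = false) ∧ ChainOK (fun t => b (t + 1)) σ := by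
  simp only [ChainOK, Fin.forall_fin_succ, Fin.cons_zero, Fin.cons_succ, Fin.val_zero, Fin.val_succ]
  have htop : (∀ t' : Fin M, (t' : ℕ) + 1 = 0 + 1 → c 1 = true → σ t' 0 = false) ↔
      (c 1 = true → top σ = false) := by
    cases M with
    | zero => simp [top]
    | succ M =>
      refine ⟨fun h => h 0 rfl, fun h t' ht => ?_⟩
      obtain rfl : t' = 0 := Fin.ext (by simpa using ht)
      exact h
  rw [htop]
  simp only [Nat.add_right_cancel_iff]
  constructor
  · rintro ⟨⟨h1, h2⟩, ⟨-, h3⟩, h4⟩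
    exact ⟨h1, h3, h2, fun t => (h4 t).2⟩
  · rintro ⟨h1, h3, h2, h4⟩
    exact ⟨⟨h1, h2⟩, ⟨by simp, h3⟩, fun t => ⟨by simp, h4 t⟩⟩

open Classical in
/-- The first unit interacts with the rest only through the edge from its vertex `1` to the root of
the rest. -/
theorem chainSum_succ (l : ℕ) (x : ℚ) (M : ℕ) (b : ℕ → Bool) (s : Bool) :
    chainSum l x (M + 1) b s =
      (∑ c : Fin (l + 3) → Bool with UnitOK (b 0) c ∧ c 0 = s ∧ c 1 = true, unitWeight x c) *
          chainSum l x M (fun t => b (t + 1)) false +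
        (∑ c : Fin (l + 3) → Bool with UnitOK (b 0) c ∧ c 0 = s ∧ c 1 = false, unitWeight x c) *
          (chainSum l x M (fun t => b (t + 1)) false +
            chainSum l x M (fun t => b (t + 1)) true) := by
  simp only [chainSum, Finset.sum_filter]
  rw [← (Fin.consEquiv fun _ : Fin (M + 1) => Fin (l + 3) → Bool).sum_comp, Fintype.sum_prod_type,
    Finset.sum_mul_sum, ← Finset.sum_add_distrib, Finset.sum_mul_sum, ← Finset.sum_add_distrib]
  refine Finset.sum_congr rfl fun c _ => ?_
  rw [← Finset.sum_add_distrib]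
  refine Finset.sum_congr rfl fun σ _ => ?_
  have htop : ∀ ρ : Fin (M + 1) → Fin (l + 3) → Bool, top ρ = ρ 0 0 := fun _ => rfl
  have hcons : ChainOK b (Fin.consEquiv (fun _ : Fin (M + 1) => Fin (l + 3) → Bool) (c, σ)) ↔ _ :=
    chainOK_cons c σ
  simp only [hcons, Fin.consEquiv_apply, htop, Fin.cons_zero, Fin.prod_univ_succ,
    Fin.cons_succ]
  by_cases h1 : UnitOK (b 0) c <;> by_cases h2 : ChainOK (fun t => b (t + 1)) σ <;>
    by_cases h3 : c 0 = s <;> by_cases h4 : c 1 = true <;>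
      by_cases h5 : top σ = true <;> simp [h1, h2, h3, h4, h5]

/-- The effect of a unit on the pair of the weights of the independent sets that avoid,
respectively contain, the root. -/
def unitStep (l : ℕ) (x : ℚ) (β : Bool) (v : ℚ × ℚ) : ℚ × ℚ :=
  ((1 + x) ^ (l + 1) * ((1 + x) * v.1 + v.2), x * (if β then 1 else 1 + x) * (v.1 + v.2))

/-- The weights of the independent sets of a caterpillar that avoid, respectively contain, the
root. -/
def rootWeights (l : ℕ) (x : ℚ) : ℕ → (ℕ → Bool) → ℚ × ℚ
  | 0, _ => (1, 0)
  | M + 1, b => unitStep l x (b 0) (rootWeights l x M fun t => b (t + 1))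

theorem chainSum_eq (l : ℕ) (x : ℚ) (M : ℕ) (b : ℕ → Bool) :
    rootWeights l x M b = (chainSum l x M b false, chainSum l x M b true) := by
  induction M generalizing b with
  | zero => simp [rootWeights, chainSum, top, ChainOK, Finset.filter_true_of_mem]
  | succ M ih =>
    rw [rootWeights, ih, chainSum_succ, chainSum_succ]
    simp only [sum_unit, unitStep]
    ext <;> simp; ring

/-! ### Attaching a caterpillar to every vertex -/

/-- Adjacency, in one direction, in the graph that arises from `G` by attaching to every vertex
the same caterpillar; vertex `(v, t, r)` is vertex `r` of unit `t` of the copy at `v`, and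
`(v, 0, 0)` is the vertex `v` of `G`. -/
def gadgetRel {n M l : ℕ} (G : SimpleGraph (Fin n)) (b : ℕ → Bool)
    (p q : Fin n × Fin M × Fin (l + 3)) : Prop :=
  (G.Adj p.1 q.1 ∧ (p.2.1 : ℕ) = 0 ∧ (p.2.2 : ℕ) = 0 ∧ (q.2.1 : ℕ) = 0 ∧ (q.2.2 : ℕ) = 0) ∨
  (p.1 = q.1 ∧ (((q.2.1 : ℕ) = p.2.1 ∧ (p.2.2 : ℕ) = 0 ∧ UnitRel (b p.2.1) q.2.2) ∨
    ((q.2.1 : ℕ) = p.2.1 + 1 ∧ (p.2.2 : ℕ) = 1 ∧ (q.2.2 : ℕ) = 0)))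

/-- The graph with a caterpillar attached to every vertex, on the vertices `0, 1, …`. -/
def gadgetGraph {n : ℕ} (G : SimpleGraph (Fin n)) (l M : ℕ) (b : ℕ → Bool) :
    SimpleGraph (Fin (n * (M * (l + 3)))) :=
  (SimpleGraph.fromRel (gadgetRel G b)).comap
    fun e => (e.divNat, e.modNat.divNat, e.modNat.modNat)

theorem isIndepConfig_gadget_iff {n M l : ℕ} (G : SimpleGraph (Fin n)) (b : ℕ → Bool)
    (σ : Fin n → Fin (M + 1) → Fin (l + 3) → Bool) :
    IsIndepConfig (SimpleGraph.fromRel (gadgetRel G b)) (fun p => σ p.1 p.2.1 p.2.2) ↔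
      (∀ v, ChainOK b (σ v)) ∧ IsIndepConfig G fun v => top (σ v) := by
  constructor
  · intro h
    have h' : ∀ p q, p ≠ q → gadgetRel G b p q → σ p.1 p.2.1 p.2.2 = true →
        σ q.1 q.2.1 q.2.2 = false := fun p q hne hr => h p q ⟨hne, .inl hr⟩
    refine ⟨fun v => ⟨fun (t : Fin (M + 1)) r hr => ?_, fun t t' ht => ?_⟩, fun v w hvw => ?_⟩
    · refine h' (v, t, 0) (v, t, r) (fun h => ?_) (.inr ⟨rfl, .inl ⟨rfl, rfl, hr⟩⟩)
      have : r = 0 := by simpa using h.symm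
      subst this
      simp [UnitRel] at hr
    · refine h' (v, t, 1) (v, t', 0) (fun h => ?_) (.inr ⟨rfl, .inr ⟨ht, rfl, rfl⟩⟩)
      simp at h
    · refine h' (v, 0, 0) (w, 0, 0) (fun h => ?_) (.inl ⟨hvw, rfl, rfl, rfl, rfl⟩)
      exact hvw.ne (by simpa using h)
  · rintro ⟨hc, hG⟩
    have key : ∀ p q, gadgetRel G b p q → σ p.1 p.2.1 p.2.2 = true →
        σ q.1 q.2.1 q.2.2 = false := by
      rintro ⟨v, t, r⟩ ⟨v', t', r'⟩ hr
      simp only [gadgetRel] at hr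
      rcases hr with ⟨ha, h1, h2, h3, h4⟩ | ⟨rfl, ⟨h1, h2, h3⟩ | ⟨h1, h2, h3⟩⟩
      · obtain rfl : t = 0 := Fin.ext h1
        obtain rfl : r = 0 := Fin.ext h2
        obtain rfl : t' = 0 := Fin.ext h3
        obtain rfl : r' = 0 := Fin.ext h4
        exact hG v v' ha
      · obtain rfl : t' = t := Fin.ext h1
        obtain rfl : r = 0 := Fin.ext h2
        exact (hc v).1 t' r' h3
      · obtain rfl : r = 1 := Fin.ext h2
        obtain rfl : r' = 0 := Fin.ext h3
        exact (hc v).2 t t' h1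
    rintro p q ⟨-, h | h⟩ hp
    · exact key p q h hp
    · by_contra hq
      simp [key q p h (by simpa using hq)] at hp

/-- Evaluating the polynomial of a gadget graph at `x` amounts to evaluating that of `G` at the
ratio of the weights of the caterpillar. -/
theorem aeval_gadgetGraph {n : ℕ} (G : SimpleGraph (Fin n)) (l M : ℕ) (b : ℕ → Bool) (x : ℚ)
    (h0 : (rootWeights l x (M + 1) b).1 ≠ 0) :
    Polynomial.aeval x (indepPoly (gadgetGraph G l (M + 1) b)) =
      (rootWeights l x (M + 1) b).1 ^ n * Polynomial.aeval
        ((rootWeights l x (M + 1) b).2 / (rootWeights l x (M + 1) b).1) (indepPoly G) := by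
  classical
  rw [← sum_config_eq G _ h0, aeval_indepPoly, chainSum_eq]
  let ψ : Fin (n * ((M + 1) * (l + 3))) ≃ Fin n × Fin (M + 1) × Fin (l + 3) :=
    finProdFinEquiv.symm.trans ((Equiv.refl _).prodCongr finProdFinEquiv.symm)
  let Φ : (Fin n → Fin (M + 1) → Fin (l + 3) → Bool) ≃ (Fin (n * ((M + 1) * (l + 3))) → Bool) :=
    (((Equiv.refl _).arrowCongr (Equiv.curry _ _ _).symm).trans (Equiv.curry _ _ _).symm).trans
      (ψ.symm.arrowCongr (Equiv.refl _))
  have hΦ : ∀ σ, Φ σ = fun e => σ (ψ e).1 (ψ e).2.1 (ψ e).2.2 := fun σ => rfl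
  have hind : ∀ σ, IsIndepConfig (gadgetGraph G l (M + 1) b) (Φ σ) ↔
      (∀ v, ChainOK b (σ v)) ∧ IsIndepConfig G fun v => top (σ v) := fun σ => by
    rw [← isIndepConfig_gadget_iff, hΦ]
    refine ⟨fun h p q hpq => ?_, fun h p q hpq => h (ψ p) (ψ q) hpq⟩
    have := h (ψ.symm p) (ψ.symm q) (by
      change (SimpleGraph.fromRel (gadgetRel G b)).Adj (ψ (ψ.symm p)) (ψ (ψ.symm q))
      simpa only [Equiv.apply_symm_apply] using hpq)
    simpa only [Equiv.apply_symm_apply] using this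
  have hw : ∀ σ, (∏ e, if Φ σ e = true then x else 1) =
      ∏ v, ∏ t, unitWeight x (σ v t) := fun σ => by
    rw [← ψ.symm.prod_comp, Fintype.prod_prod_type]
    simp only [hΦ, Equiv.apply_symm_apply, Fintype.prod_prod_type, unitWeight]
  rw [Finset.sum_filter, ← Φ.sum_comp]
  simp only [hind, hw]
  have := sum_prod_root (V := Fin n) (IsIndepConfig G)
    (fun σ : Fin (M + 1) → Fin (l + 3) → Bool => top σ)
    (fun σ => if ChainOK b σ then ∏ t, unitWeight x (σ t) else 0)
  calc _ = ∑ σ : Fin n → Fin (M + 1) → Fin (l + 3) → Bool with IsIndepConfig G fun v => top (σ v),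
        ∏ v, if ChainOK b (σ v) then ∏ t, unitWeight x (σ v t) else 0 := by
        rw [Finset.sum_filter]
        refine Finset.sum_congr rfl fun σ _ => ?_
        by_cases h1 : IsIndepConfig G fun v => top (σ v)
        · by_cases h2 : ∀ v, ChainOK b (σ v)
          · simp [h1, h2]
          · obtain ⟨v, hv⟩ := not_forall.1 h2
            rw [if_neg fun h => h2 h.1, if_pos h1, Finset.prod_eq_zero (mem_univ v) (if_neg hv)]
        · simp [h1]
    _ = _ := by
        rw [this]
        refine Finset.sum_congr rfl fun S _ => Finset.prod_congr rfl fun v _ => ?_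
        rw [← Finset.sum_filter, Finset.filter_filter]
        cases h : S v <;> simp [chainSum, and_comm]

end IndepSetPoly

namespace IndepSetPoly

open Finset

/-! ### Different gadgets have different weights -/

/-- Suppose that the unit steps preserve a set `K` of weights on which two different steps never
give proportional results. Then different bit sequences give non-proportional weights. -/
theorem rootWeights_cross_ne {l : ℕ} {x : ℚ} (hx : x ≠ 0) (hx1 : 1 + x ≠ 0) {K : ℚ × ℚ → Prop}
    (h0 : K (1, 0)) (hstep : ∀ v β, K v → K (unitStep l x β v))
    (hK : ∀ v w, K v → K w → (1 + x) * (v.1 * w.1) + (2 + x) * (v.1 * w.2) + v.2 * w.2 ≠ 0) :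
    ∀ (M : ℕ) (b b' : ℕ → Bool), K (rootWeights l x M b) ∧ ((∃ t < M, b t ≠ b' t) →
      (rootWeights l x M b).2 * (rootWeights l x M b').1 -
        (rootWeights l x M b).1 * (rootWeights l x M b').2 ≠ 0) := by
  intro M
  induction M with
  | zero => exact fun b b' => ⟨h0, fun ⟨t, ht, _⟩ => absurd ht (Nat.not_lt_zero t)⟩
  | succ M ih =>
    intro b b'
    have hv := (ih (fun t => b (t + 1)) fun t => b' (t + 1))
    have hw := (ih (fun t => b' (t + 1)) fun t => b (t + 1)).1
    refine ⟨hstep _ _ hv.1, fun ⟨t, ht, hne⟩ => ?_⟩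
    simp only [rootWeights]
    set v := rootWeights l x M fun t => b (t + 1)
    set w := rootWeights l x M fun t => b' (t + 1)
    have hD : (1 + x) ^ (l + 1) ≠ 0 := pow_ne_zero _ hx1
    by_cases hb : b 0 = b' 0
    · have ht' : ∃ t < M, b (t + 1) ≠ b' (t + 1) := by
        cases t with
        | zero => exact absurd hb hne
        | succ t => exact ⟨t, by omega, hne⟩
      have hδ : (if b' 0 = true then (1 : ℚ) else 1 + x) ≠ 0 := by split_ifs <;> simp [hx1]
      have := mul_ne_zero (mul_ne_zero (mul_ne_zero hD (mul_ne_zero hx hx)) hδ) (hv.2 ht')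
      rw [hb]
      convert this using 1
      simp only [unitStep]
      ring
    · have h1 := mul_ne_zero (mul_ne_zero hD (mul_ne_zero hx hx)) (hK v w hv.1 hw)
      have h2 := mul_ne_zero (mul_ne_zero hD (mul_ne_zero hx hx)) (hK w v hw hv.1)
      cases hb0 : b 0 <;> cases hb1 : b' 0 <;> simp only [hb0, hb1, not_true] at hb
      · convert h2 using 1
        simp only [unitStep]
        simp; ring
      · convert neg_ne_zero.2 h1 using 1
        simp only [unitStep]
        simp; ring

/-- For a suitable number of leaves the weights of the gadgets are pairwise non-proportional. For
negative `x` so many leaves are attached that every unit has a ratio of weights less than `-2`. -/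
theorem exists_leaves {x : ℚ} (hx : x ≠ 0) (hx1 : -1 < x) :
    ∃ l : ℕ, ∀ (M : ℕ) (b b' : ℕ → Bool), (rootWeights l x M b).1 ≠ 0 ∧ ((∃ t < M, b t ≠ b' t) →
      (rootWeights l x M b).2 * (rootWeights l x M b').1 -
        (rootWeights l x M b).1 * (rootWeights l x M b').2 ≠ 0) := by
  have hd : 0 < 1 + x := by linarith
  rcases hx.lt_or_gt with hneg | hpos
  · -- The bound makes `|x| / (1 + x) ^ (l - 1)` exceed `2`, so that the ratios `y < -2` persist.
    obtain ⟨l, hl⟩ := exists_pow_lt_of_lt_one (show 0 < -x * (1 + x) / 2 by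
      have := mul_pos (neg_pos.2 hneg) hd; linarith) (show 1 + x < 1 by linarith)
    -- The ratio `y = 0` is that of the empty caterpillar.
    let K : ℚ × ℚ → Prop := fun v => ∃ a y, a ≠ 0 ∧ v = (a, a * y) ∧ (y = 0 ∨ y < -2)
    have key := rootWeights_cross_ne (l := l) hx hd.ne' (K := K) ⟨1, 0, by simp⟩ ?_ ?_
    · refine ⟨l, fun M b b' => ⟨?_, (key M b b').2⟩⟩
      obtain ⟨a, y, ha, h, -⟩ := (key M b b').1
      rw [h]; exact ha
    · rintro _ β ⟨a, y, ha, rfl, hy⟩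
      have hdy : 1 + x + y ≠ 0 := by
        rcases hy with rfl | hy <;> intro h <;> linarith
      have hD : 0 < (1 + x) ^ (l + 1) := pow_pos hd _
      set δ : ℚ := if β = true then 1 else 1 + x with hδ
      have hδ' : 1 + x ≤ δ := by rw [hδ]; split_ifs <;> linarith
      have hr : 1 + x ≤ (1 + y) / (1 + x + y) := by
        rcases hy with rfl | hy
        · rw [le_div_iff₀ (by linarith)]; nlinarith
        · rw [le_div_iff_of_neg (by linarith)]; nlinarith
      refine ⟨(1 + x) ^ (l + 1) * (a * (1 + x + y)),
        x * (δ * ((1 + y) / (1 + x + y))) / (1 + x) ^ (l + 1), ?_, ?_, .inr ?_⟩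
      · exact mul_ne_zero hD.ne' (mul_ne_zero ha hdy)
      · simp only [unitStep, ← hδ]
        ext
        · simp only; ring
        · simp only; field_simp
      · rw [div_lt_iff₀ hD, pow_succ]
        have h1 : (1 + x) * (1 + x) ≤ δ * ((1 + y) / (1 + x + y)) :=
          mul_le_mul hδ' hr hd.le (hd.le.trans hδ')
        have h2 := mul_le_mul_of_nonneg_left h1 (neg_pos.2 hneg).le
        have h3 := mul_lt_mul_of_pos_right hl hd
        nlinarith
    · rintro _ _ ⟨a, y, ha, rfl, hy⟩ ⟨c, z, hc, rfl, hz⟩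
      have : (1 + x) * (a * c) + (2 + x) * (a * (c * z)) + a * y * (c * z) =
          a * c * ((1 + x) + (2 + x) * z + y * z) := by ring
      simp only [this]
      refine mul_ne_zero (mul_ne_zero ha hc) ?_
      rcases hy with rfl | hy
      · rcases hz with rfl | hz
        · simpa using hd.ne'
        · nlinarith
      · rcases hz with rfl | hz
        · simpa using hd.ne'
        · nlinarith
  · let K : ℚ × ℚ → Prop := fun v => 0 < v.1 ∧ 0 ≤ v.2
    have key := rootWeights_cross_ne (l := 0) hx hd.ne' (K := K) ⟨by simp, by simp⟩ ?_ ?_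
    · exact ⟨0, fun M b b' => ⟨(key M b b').1.1.ne', (key M b b').2⟩⟩
    · rintro v β ⟨h1, h2⟩
      refine ⟨by simp only [unitStep]; positivity, ?_⟩
      simp only [unitStep]
      split_ifs <;> positivity
    · rintro v w ⟨h1, h2⟩ ⟨h3, h4⟩
      positivity

/-! ### Gadget weights as integers -/

/-- The unit step for `x = α / β`, multiplied by `β ^ (l + 3)`. -/
def intStep (l : ℕ) (α β : ℤ) (δ : Bool) (v : ℤ × ℤ) : ℤ × ℤ :=
  (β * (α + β) ^ (l + 1) * ((α + β) * v.1 + β * v.2),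
    α * β ^ (l + 1) * (if δ then β else α + β) * (v.1 + v.2))

/-- The weights of a caterpillar with `M` units, multiplied by `β ^ ((l + 3) * M)`. -/
def intWeights (l : ℕ) (α β : ℤ) : ℕ → (ℕ → Bool) → ℤ × ℤ
  | 0, _ => (1, 0)
  | M + 1, b => intStep l α β (b 0) (intWeights l α β M fun t => b (t + 1))

theorem intWeights_eq (l : ℕ) (x : ℚ) (M : ℕ) (b : ℕ → Bool) :
    ((intWeights l x.num x.den M b).1 : ℚ) = (x.den : ℚ) ^ ((l + 3) * M) * (rootWeights l x M b).1 ∧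
    ((intWeights l x.num x.den M b).2 : ℚ) =
      (x.den : ℚ) ^ ((l + 3) * M) * (rootWeights l x M b).2 := by
  induction M generalizing b with
  | zero => simp [intWeights, rootWeights]
  | succ M ih =>
    obtain ⟨h1, h2⟩ := ih fun t => b (t + 1)
    have hnum : (x.num : ℚ) = x * x.den := (Rat.mul_den_eq_num x).symm
    have hsum : (x.num : ℚ) + x.den = (1 + x) * x.den := by rw [hnum]; ring
    simp only [intWeights, rootWeights, intStep, unitStep]
    push_cast
    rw [h1, h2, hsum]
    constructor
    · rw [mul_pow]; ring
    · rw [hnum]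
      split_ifs <;> ring

/-! ### Interpolation -/

open Classical in
theorem coeff_indepPoly_eq {n : ℕ} (G : SimpleGraph (Fin n)) (k : ℕ) : ∃ c ≤ 2 ^ n,
    (indepPoly G).coeff k = (c : ℕ) := by
  rw [indepPoly, Polynomial.finsetSum_coeff]
  simp only [Polynomial.coeff_X_pow]
  refine ⟨_, ?_, Finset.sum_boole _ _⟩
  have h : Fintype.card (Finset (Fin n)) = 2 ^ n := by
    rw [Fintype.card_finset, Fintype.card_fin]
  rw [← h]
  exact Finset.card_le_univ _

theorem coeff_indepPoly {n : ℕ} (G : SimpleGraph (Fin n)) (k : ℕ) :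
    0 ≤ (indepPoly G).coeff k ∧ (indepPoly G).coeff k ≤ 2 ^ n := by
  obtain ⟨c, hc, h⟩ := coeff_indepPoly_eq G k
  rw [h]
  exact ⟨Int.natCast_nonneg c, by exact_mod_cast hc⟩

theorem natDegree_indepPoly_le {n : ℕ} (G : SimpleGraph (Fin n)) : (indepPoly G).natDegree ≤ n := by
  classical
  refine Polynomial.natDegree_sum_le_of_forall_le _ _ fun A _ => ?_
  refine (Polynomial.natDegree_X_pow_le _).trans ?_
  simpa using Finset.card_le_univ A

/-- Lagrange interpolation in homogeneous coordinates. -/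
theorem homogeneous_lagrange {p : Polynomial ℤ} {n : ℕ} (hp : p.natDegree ≤ n) {P Q : ℕ → ℚ}
    (hQ : ∀ i, Q i ≠ 0)
    (hPQ : ∀ i ∈ range (n + 1), ∀ j ∈ range (n + 1), j ≠ i → P i * Q j - Q i * P j ≠ 0)
    {r s : ℚ} (hs : s ≠ 0) :
    s ^ n * Polynomial.aeval (r / s) p = ∑ i ∈ range (n + 1),
      Q i ^ n * Polynomial.aeval (P i / Q i) p *
        ∏ j ∈ range (n + 1),
          if j = i then 1 else (r * Q j - s * P j) / (P i * Q j - Q i * P j) := by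
  have hinj : Set.InjOn (fun i => P i / Q i) (range (n + 1) : Finset ℕ) := by
    intro i hi j hj h
    by_contra hne
    refine hPQ i hi j hj (Ne.symm hne) ?_
    have := (div_eq_div_iff (hQ i) (hQ j)).1 h
    rw [this]; ring
  have hdeg : (p.map (Int.castRingHom ℚ)).degree < #(range (n + 1)) := by
    rw [card_range]
    refine (Polynomial.degree_le_natDegree).trans_lt ?_
    exact_mod_cast (Polynomial.natDegree_map_le.trans hp).trans_lt (Nat.lt_succ_self n)
  have haev : ∀ y : ℚ, Polynomial.aeval y p = (p.map (Int.castRingHom ℚ)).eval y := fun y => by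
    rw [Polynomial.eval_map, Polynomial.aeval_def]; rfl
  have hL := congrArg (Polynomial.eval (r / s)) (Lagrange.eq_interpolate hinj hdeg)
  rw [Lagrange.interpolate_apply, Polynomial.eval_finsetSum] at hL
  rw [haev, hL, Finset.mul_sum]
  refine Finset.sum_congr rfl fun i hi => ?_
  rw [Polynomial.eval_mul, Polynomial.eval_C, ← haev, Lagrange.basis, Polynomial.eval_prod]
  have hprod : (∏ j ∈ range (n + 1), if j = i then (1 : ℚ) else
      (r * Q j - s * P j) / (P i * Q j - Q i * P j)) =
      ∏ j ∈ (range (n + 1)).erase i, (r * Q j - s * P j) / (P i * Q j - Q i * P j) := by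
    rw [← Finset.mul_prod_erase _ _ hi, if_pos rfl, one_mul]
    exact Finset.prod_congr rfl fun j hj => if_neg (Finset.ne_of_mem_erase hj)
  have hfac : ∀ j ∈ (range (n + 1)).erase i,
      Polynomial.eval (r / s) (Lagrange.basisDivisor (P i / Q i) (P j / Q j)) =
        Q i / s * ((r * Q j - s * P j) / (P i * Q j - Q i * P j)) := fun j hj => by
    have hj' := Finset.mem_erase.1 hj
    have h := hPQ i hi j hj'.2 hj'.1
    have h1 := hQ i
    have h2 := hQ j
    have h3 : P i / Q i - P j / Q j = (P i * Q j - Q i * P j) / (Q i * Q j) := by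
      rw [div_sub_div _ _ h1 h2]
    simp only [Lagrange.basisDivisor, Polynomial.eval_mul, Polynomial.eval_C, Polynomial.eval_sub,
      Polynomial.eval_X, h3, inv_div]
    field_simp
  rw [hprod, Finset.prod_congr rfl hfac, Finset.prod_mul_distrib, Finset.prod_const,
    Finset.card_erase_of_mem hi, card_range, Nat.add_sub_cancel, div_pow]
  field_simp

/-- The coefficients of a polynomial are the digits of its value at a large base. -/
theorem eval_ediv_emod {Z : ℤ} (p : Polynomial ℤ) (h : ∀ k, 0 ≤ p.coeff k ∧ p.coeff k < Z) (k : ℕ) :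
    p.eval Z / Z ^ k % Z = p.coeff k := by
  have hZ : 0 < Z := (h 0).1.trans_lt (h 0).2
  induction k generalizing p with
  | zero =>
    conv_lhs => rw [← p.divX_mul_X_add]
    simp [Int.emod_eq_of_lt (h 0).1 (h 0).2]
  | succ k ih =>
    have := ih p.divX fun k => by simpa [Polynomial.coeff_divX] using h (k + 1)
    rw [Polynomial.coeff_divX] at this
    rw [← this, pow_succ', ← Int.ediv_ediv_of_nonneg hZ.le]
    congr 2
    conv_lhs => rw [← p.divX_mul_X_add]
    simp only [Polynomial.eval_add, Polynomial.eval_mul, Polynomial.eval_X, Polynomial.eval_C]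
    rw [Int.add_comm, Int.add_mul_ediv_right _ _ hZ.ne', Int.ediv_eq_zero_of_lt (h 0).1 (h 0).2,
      zero_add]

end IndepSetPoly

namespace WhileProg.PT

variable {ι : Type} {e : ι → Val} {μ : ι → ℕ} {k : ι → ℕ}

/-! ### The gadget graphs are computed in polynomial time -/

theorem encodeGraph {N : ι → ℕ} {G : ∀ x, SimpleGraph (Fin (N x))} (he : PT e μ e)
    (hN : PT e μ fun x => .int (N x)) (hNb : PolyBdd μ N)
    (hG : PTP (ext (ext e N) fun y => N y.1) (fun z => μ z.1.1)
      fun z => (G z.1.1).Adj z.1.2 z.2) :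
    PT e μ fun x => IndepSetPoly.encodeGraph (G x) :=
  hN.pair (tabulate he hN hNb (tabulate (ext_self he hNb) (weaken he hNb hN)
    (hNb.comap Sigma.fst) hG))

theorem nat_of_encodeGraph {n : ι → ℕ} {G : ∀ x, SimpleGraph (Fin (n x))}
    (hG : PT e μ fun x => IndepSetPoly.encodeGraph (G x)) : PT e μ fun x => .int (n x) :=
  hG.fst

/-- `Nat.size n` is the number of the powers of `2` that are at most `n`. -/
theorem size {n : ι → ℕ} (he : PT e μ e) (hn : PT e μ fun x => .int (n x)) (hnb : PolyBdd μ n) :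
    PT e μ fun x => .int (Nat.size (n x) : ℕ) := by
  have h2 : PT (ext e n) (fun y => μ y.1) fun y => .int (2 ^ (y.2 : ℕ)) :=
    pow (ext_self he hnb) (const 2) (index he hnb) (hnb.comap Sigma.fst |>.mono fun y => y.2.2.le)
  refine (sum (a := fun x j => if (2 : ℤ) ^ j ≤ n x then 1 else 0) he hn hnb
    (PT.congr (PTP.le h2 (weaken he hnb hn)) fun y => by congr)).congr fun x => ?_
  have hset : (Finset.range (n x)).filter (fun j => (2 : ℤ) ^ j ≤ n x) =
      Finset.range (Nat.size (n x)) := by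
    ext j
    simp only [Finset.mem_filter, Finset.mem_range, Nat.lt_size]
    have hcast : (2 : ℤ) ^ j ≤ n x ↔ 2 ^ j ≤ n x := by exact_mod_cast Iff.rfl
    rw [hcast]
    exact ⟨fun h => h.2, fun h => ⟨j.lt_two_pow_self.trans_le h, h⟩⟩
  rw [Finset.sum_boole, hset, Finset.card_range]

end WhileProg.PT

namespace WhileProg.PTP

variable {κ : Type} {e : κ → Val} {μ : κ → ℕ}

theorem adj {n : κ → ℕ} {G : ∀ y, SimpleGraph (Fin (n y))} {u v : ∀ y, Fin (n y)} (he : PT e μ e)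
    (hG : PT e μ fun y => IndepSetPoly.encodeGraph (G y)) (hn : PolyBdd μ n)
    (hu : PT e μ fun y => .int (u y : ℕ)) (hv : PT e μ fun y => .int (v y : ℕ)) :
    PTP e μ fun y => (G y).Adj (u y) (v y) := by
  classical
  have h1 := PT.lookup he hG.snd hu (hn.mono fun y => (u y).2.le)
  have h2 : PT e μ fun y => Val.ofList (List.ofFn fun j : Fin (n y) =>
      .int (if (G y).Adj (u y) j then 1 else 0)) := h1.congr fun y => by
    rw [List.getD_eq_getElem _ _ (by simp), List.getElem_ofFn]
  refine (PT.lookup he h2 hv (hn.mono fun y => (v y).2.le)).congr fun y => ?_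
  rw [List.getD_eq_getElem _ _ (by simp), List.getElem_ofFn]

theorem testBit {i t B : κ → ℕ} (he : PT e μ e) (hi : PT e μ fun y => .int (i y))
    (ht : PT e μ fun y => .int (t y)) (htb : PolyBdd μ B) (hB : ∀ y, t y ≤ B y) :
    PTP e μ fun y => (i y).testBit (t y) = true := by
  have h2 : PT e μ fun y => .int ((2 ^ t y : ℕ) : ℤ) :=
    (PT.pow he (PT.const 2) ht (htb.mono hB)).congr fun y => by simp
  have h3 := PTP.natEq (b := fun _ => 1)
    ((hi.natDiv h2).natMod (b := fun _ => 2) (PT.const 2)) (PT.const 1)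
  exact h3.congr fun y => by rw [Nat.testBit_eq_decide_div_mod_eq, decide_eq_true_eq]

end WhileProg.PTP

namespace IndepSetPoly

open WhileProg

/-- The position of a vertex of a gadget graph. -/
def gadgetPos {n M l : ℕ} (e : Fin (n * (M * (l + 3)))) : Fin n × Fin M × Fin (l + 3) :=
  (e.divNat, e.modNat.divNat, e.modNat.modNat)

theorem gadgetGraph_adj {n l M : ℕ} (G : SimpleGraph (Fin n)) (b : ℕ → Bool)
    (e e' : Fin (n * (M * (l + 3)))) : (gadgetGraph G l M b).Adj e e' ↔
      gadgetRel G b (gadgetPos e) (gadgetPos e') ∨ gadgetRel G b (gadgetPos e') (gadgetPos e) := by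
  have hirr : ∀ p : Fin n × Fin M × Fin (l + 3), ¬ gadgetRel G b p p := by
    rintro ⟨v, t, r⟩ (⟨h, -⟩ | ⟨-, ⟨-, h1, h2⟩ | ⟨h, -⟩⟩)
    · exact G.irrefl h
    · simp only [UnitRel] at h1 h2; omega
    · simp only at h; omega
  refine ⟨fun h => h.2, fun h => ⟨fun heq => ?_, h⟩⟩
  have heq' : gadgetPos e = gadgetPos e' := heq
  rw [heq'] at h
  exact h.elim (hirr _) (hirr _)

section

variable {κ : Type} {e : κ → Val} {μ : κ → ℕ}

theorem ptp_gadgetRel {l : ℕ} {n M i : κ → ℕ} {G : ∀ y, SimpleGraph (Fin (n y))}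
    {E E' : ∀ y, Fin (n y * (M y * (l + 3)))} (he : PT e μ e)
    (hG : PT e μ fun y => encodeGraph (G y)) (hn : PolyBdd μ n)
    (hi : PT e μ fun y => .int (i y)) (hM : PT e μ fun y => .int (M y)) (hMb : PolyBdd μ M)
    (hE : PT e μ fun y => .int (E y : ℕ)) (hE' : PT e μ fun y => .int (E' y : ℕ)) :
    PTP e μ fun y => gadgetRel (G y) (i y).testBit (gadgetPos (E y)) (gadgetPos (E' y)) := by
  have hc : ∀ c : ℕ, PT e μ fun _ => .int ((c : ℕ) : ℤ) := fun c => PT.const c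
  have hL := hc (l + 3)
  have hML := hM.natMul hL
  have pos : ∀ {F : ∀ y, Fin (n y * (M y * (l + 3)))}, (PT e μ fun y => .int (F y : ℕ)) →
      (PT e μ fun y => .int ((gadgetPos (F y)).1 : ℕ)) ∧
      (PT e μ fun y => .int ((gadgetPos (F y)).2.1 : ℕ)) ∧
      (PT e μ fun y => .int ((gadgetPos (F y)).2.2 : ℕ)) := fun hF =>
    ⟨hF.natDiv hML, (hF.natMod hML).natDiv hL, (hF.natMod hML).natMod hL⟩
  obtain ⟨v, t, r⟩ := pos hE
  obtain ⟨v', t', r'⟩ := pos hE'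
  have hbit := PTP.testBit he hi t hMb fun y => (gadgetPos (E y)).2.1.2.le
  have hunit : PTP e μ fun y =>
      UnitRel ((i y).testBit (gadgetPos (E y)).2.1) (gadgetPos (E' y)).2.2 :=
    (PTP.natEq r' (hc 1)).or ((PTP.natLe (hc 3) r').or ((PTP.natEq r' (hc 2)).and hbit))
  have hv : PTP e μ fun y => (gadgetPos (E y)).1 = (gadgetPos (E' y)).1 :=
    (PTP.natEq v v').congr fun y => Fin.ext_iff
  exact ((PTP.adj he hG hn v v').and ((PTP.natEq t (hc 0)).and ((PTP.natEq r (hc 0)).and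
    ((PTP.natEq t' (hc 0)).and (PTP.natEq r' (hc 0)))))).or (hv.and
    (((PTP.natEq t' t).and ((PTP.natEq r (hc 0)).and hunit)).or
      ((PTP.natEq t' (t.natAdd (hc 1))).and ((PTP.natEq r (hc 1)).and (PTP.natEq r' (hc 0))))))

theorem pt_gadgetGraph {l : ℕ} {n M i : κ → ℕ} {G : ∀ y, SimpleGraph (Fin (n y))} (he : PT e μ e)
    (hG : PT e μ fun y => encodeGraph (G y)) (hn : PolyBdd μ n)
    (hi : PT e μ fun y => .int (i y)) (hM : PT e μ fun y => .int (M y)) (hMb : PolyBdd μ M) :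
    PT e μ fun y => encodeGraph (gadgetGraph (G y) l (M y) (i y).testBit) := by
  have hN : PT e μ fun y => .int ((n y * (M y * (l + 3)) : ℕ) : ℤ) :=
    hG.nat_of_encodeGraph.natMul (hM.natMul (PT.const ((l + 3 : ℕ) : ℤ)))
  have hNb : PolyBdd μ fun y => n y * (M y * (l + 3)) := hn.mul (hMb.mul (.const _))
  have he1 := PT.ext_self he hNb
  have hNb1 := hNb.comap (Sigma.fst : (Σ y, Fin (n y * (M y * (l + 3)))) → κ)
  have he2 := PT.ext_self he1 hNb1
  have hw : ∀ {f : κ → Val}, PT e μ f → PT _ _ fun z :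
      Σ w : Σ y, Fin (n y * (M y * (l + 3))), Fin (n w.1 * (M w.1 * (l + 3))) => f z.1.1 :=
    fun hf =>
    PT.weaken he1 hNb1 (PT.weaken he hNb hf)
  have hE := PT.weaken he1 hNb1 (PT.index he hNb)
  have hE' := PT.index he1 hNb1
  refine PT.encodeGraph he hN hNb (PTP.congr ?_ fun z => gadgetGraph_adj _ _ _ _)
  exact (ptp_gadgetRel he2 (hw hG) ((hn.comap Sigma.fst).comap Sigma.fst) (hw hi) (hw hM)
      ((hMb.comap Sigma.fst).comap Sigma.fst) hE hE').or
    (ptp_gadgetRel he2 (hw hG) ((hn.comap Sigma.fst).comap Sigma.fst) (hw hi) (hw hM)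
      ((hMb.comap Sigma.fst).comap Sigma.fst) hE' hE)

/-- A pair of integers as a value. -/
def pairVal (v : ℤ × ℤ) : Val := .pair (.int v.1) (.int v.2)

theorem bits_intStep_le (l : ℕ) (α β : ℤ) : ∃ c, ∀ (δ : Bool) (v : ℤ × ℤ),
    (pairVal (intStep l α β δ v)).bits ≤ (pairVal v).bits + c := by
  refine ⟨bitLength (β * (α + β) ^ (l + 1)) + bitLength (α + β) + bitLength β + 1 +
    bitLength (α * β ^ (l + 1) * (α + β)) + bitLength (α * β ^ (l + 1) * β), fun δ v => ?_⟩
  have h1 := bitLength_mul_le (β * (α + β) ^ (l + 1)) ((α + β) * v.1 + β * v.2)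
  have h2 := bitLength_add_le ((α + β) * v.1) (β * v.2)
  have h3 := bitLength_mul_le (α + β) v.1
  have h4 := bitLength_mul_le β v.2
  have h5 := bitLength_add_le v.1 v.2
  have h6 := bitLength_mul_le (α * β ^ (l + 1) * (if δ then β else α + β)) (v.1 + v.2)
  simp only [pairVal, Val.bits, intStep]
  cases δ <;> simp only [if_true, Bool.false_eq_true, if_false] at h6 ⊢ <;> omega

theorem pt_intWeights {l : ℕ} {α β : ℤ} {M i : κ → ℕ} (he : PT e μ e)
    (hi : PT e μ fun y => .int (i y)) (hM : PT e μ fun y => .int (M y)) (hMb : PolyBdd μ M) :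
    PT e μ fun y => pairVal (intWeights l α β (M y) (i y).testBit) := by
  obtain ⟨c, hc⟩ := bits_intStep_le l α β
  have hbits : ∀ j b, (pairVal (intWeights l α β j b)).bits ≤ 2 + c * j := fun j => by
    induction j with
    | zero => exact fun b => by simp [intWeights, pairVal, Val.bits, bitLength]
    | succ j ih => exact fun b => (hc _ _).trans (by
        have := ih fun t => b (t + 1)
        rw [mul_add]; omega)
  -- The caterpillar is built from its far end, so that state `j` comprises the last `j` units.
  set st : κ → ℕ → Val := fun y j =>
    pairVal (intWeights l α β j fun t => (i y).testBit (t + (M y - j))) with hst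
  have hb : PolyBdd μ fun y => 2 + c * M y := (PolyBdd.const 2).add ((PolyBdd.const c).mul hMb)
  have hctx := PT.loopCtx (st := st) he hMb ((hb.comap Sigma.fst).mono fun y =>
    (hbits _ _).trans (Nat.add_le_add_left (Nat.mul_le_mul_left c y.2.2.le) 2))
  have hw : ∀ {f : κ → Val}, PT e μ f →
      PT _ _ fun y : Σ y, Fin (M y) => f y.1 := fun hf =>
    hf.comp Sigma.fst hctx.fst fun _ => le_rfl
  have hidx : PT _ _ fun y : Σ y, Fin (M y) => .int ((M y.1 - 1 - y.2 : ℕ) : ℤ) :=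
    (((hw hM).sub (b := fun y : Σ y, Fin (M y) => ((y.2 : ℕ) : ℤ)) hctx.snd.fst).sub
      (PT.const 1)).congr fun y => by congr 1; have := y.2.2; omega
  have hbit := PTP.testBit hctx (hw hi) hidx (hMb.comap Sigma.fst) fun y => by omega
  have hO : PT _ _ fun y : Σ y, Fin (M y) => .int (intWeights l α β y.2 fun t =>
    (i y.1).testBit (t + (M y.1 - y.2))).1 := hctx.snd.snd.fst
  have hI : PT _ _ fun y : Σ y, Fin (M y) => .int (intWeights l α β y.2 fun t =>
    (i y.1).testBit (t + (M y.1 - y.2))).2 := hctx.snd.snd.snd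
  have hstep := (((PT.const (β * (α + β) ^ (l + 1))).mul (((PT.const (α + β)).mul hO).add
    ((PT.const β).mul hI))).pair (((PT.const (α * β ^ (l + 1))).mul
      (hbit.ite (PT.const β) (PT.const (α + β)))).mul (hO.add hI)))
  refine (PT.iterate (st := st) (((PT.const 1).pair (PT.const 0)).congr fun y => rfl) hM hMb
    (hstep.congr fun y => ?_) (hb.mono fun y => hbits _ _)).congr fun y => ?_
  · have h1 : ∀ t, t + 1 + (M y.1 - (y.2 + 1)) = t + (M y.1 - y.2) := fun t => by
      have := y.2.2; omega
    have h2 : 0 + (M y.1 - (y.2 + 1)) = M y.1 - 1 - y.2 := by omega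
    simp only [hst, pairVal, intWeights, intStep, h1, h2]
    congr!
  · simp [hst]

end

end IndepSetPoly

namespace WhileProg.PT

variable {ι : Type} {e : ι → Val} {μ : ι → ℕ} {k : ι → ℕ}

/-! ### The reduction -/

/-- A function computed for the index of a loop is also computed for the index of a further loop
nested inside it. -/
theorem inner {f : ι → ℕ → ℤ} (he : PT e μ e) (hk : PolyBdd μ k)
    (hf : PT (ext e k) (fun y => μ y.1) fun y => .int (f y.1 y.2)) :
    PT (ext (ext e k) fun y => k y.1) (fun z => μ z.1.1) fun z => .int (f z.1.1 z.2) :=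
  hf.comp (fun z : Σ y : Σ x, Fin (k x), Fin (k y.1) => (⟨z.1.1, z.2⟩ : Σ x, Fin (k x)))
    ((weaken (ext_self he hk) (hk.comap Sigma.fst) (weaken he hk he)).pair
      (index (ext_self he hk) (hk.comap Sigma.fst))) fun _ => le_rfl

/-- Products that omit the current index of an outer loop, as they occur in interpolation. -/
theorem prod_except {f : ι → ℕ → ℕ → ℤ} (he : PT e μ e) (hk : PT e μ fun x => .int (k x))
    (hkb : PolyBdd μ k) (hf : PT (ext (ext e k) fun y => k y.1) (fun z => μ z.1.1)
      fun z => .int (f z.1.1 z.1.2 z.2)) :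
    PT (ext e k) (fun y => μ y.1)
      fun y => .int (∏ j ∈ Finset.range (k y.1), if j = (y.2 : ℕ) then 1 else f y.1 y.2 j) := by
  have he1 := ext_self he hkb
  have hkb1 := hkb.comap (Sigma.fst : (Σ x, Fin (k x)) → ι)
  refine prod (a := fun (y : Σ x, Fin (k x)) j => if j = (y.2 : ℕ) then 1 else f y.1 y.2 j)
    he1 (weaken he hkb hk) hkb1 (PT.congr (PTP.ite (PTP.natEq (index he1 hkb1)
      (weaken he1 hkb1 (index he hkb))) (const 1) hf) fun z => by congr)

/-- The sum of the fractions `a i / b i` over a common denominator. -/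
theorem sum_fractions {a b : ι → ℕ → ℤ} (he : PT e μ e) (hk : PT e μ fun x => .int (k x))
    (hkb : PolyBdd μ k) (ha : PT (ext e k) (fun y => μ y.1) fun y => .int (a y.1 y.2))
    (hb : PT (ext e k) (fun y => μ y.1) fun y => .int (b y.1 y.2))
    (hb0 : ∀ x, ∀ i ∈ Finset.range (k x), b x i ≠ 0) :
    ∃ p q : ι → ℤ, (PT e μ fun x => .int (p x)) ∧ (PT e μ fun x => .int (q x)) ∧
      ∀ x, q x ≠ 0 ∧ (p x : ℚ) / q x = ∑ i ∈ Finset.range (k x), (a x i : ℚ) / b x i := by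
  refine ⟨fun x => ∑ i ∈ Finset.range (k x), a x i *
      ∏ j ∈ Finset.range (k x), if j = i then 1 else b x j,
    fun x => ∏ i ∈ Finset.range (k x), b x i,
    sum (a := fun x i => a x i * ∏ j ∈ Finset.range (k x), if j = i then 1 else b x j) he hk hkb
      (ha.mul (prod_except (f := fun x _ j => b x j) he hk hkb (inner he hkb hb))),
    prod he hk hkb hb, fun x => ⟨Finset.prod_ne_zero_iff.2 (hb0 x), ?_⟩⟩
  push_cast
  rw [Finset.sum_div]
  refine Finset.sum_congr rfl fun i hi => ?_
  have hne : ∀ j ∈ Finset.range (k x), (b x j : ℚ) ≠ 0 := fun j hj => by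
    exact_mod_cast hb0 x j hj
  have hprod : (∏ j ∈ Finset.range (k x), if j = i then (1 : ℚ) else b x j) =
      ∏ j ∈ (Finset.range (k x)).erase i, (b x j : ℚ) := by
    rw [← Finset.mul_prod_erase _ _ hi, if_pos rfl, one_mul]
    exact Finset.prod_congr rfl fun j hj => if_neg (Finset.ne_of_mem_erase hj)
  have h1 := hne i hi
  have h2 : (∏ j ∈ (Finset.range (k x)).erase i, (b x j : ℚ)) ≠ 0 :=
    Finset.prod_ne_zero_iff.2 fun j hj => hne j (Finset.mem_of_mem_erase hj)
  rw [hprod, ← Finset.mul_prod_erase _ (fun j => (b x j : ℚ)) hi]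
  field_simp

end WhileProg.PT

namespace IndepSetPoly

open WhileProg

/-- All input graphs. -/
abbrev Input : Type := Σ n, SimpleGraph (Fin n)

/-- The encoding of an input graph. -/
noncomputable abbrev encodeInput (x : Input) : Val := encodeGraph x.2

theorem pt_encodeInput {μ : Input → ℕ} (hμ : PolyBdd μ fun x => x.1) :
    PT encodeInput μ encodeInput := by
  refine .id ((hμ.add (.const 3)).mono fun x => max_le ?_ ?_)
  · refine (bitLength_le_iff.2 ?_ : bitLength x.1 ≤ x.1 + 1).trans (by omega)
    exact Nat.lt_two_pow_self
  · refine Val.bits_ofList_le (by omega) fun v hv => ?_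
    obtain ⟨i, rfl⟩ := List.mem_ofFn.1 hv
    refine Val.bits_ofList_le (by omega) fun v hv => ?_
    obtain ⟨j, rfl⟩ := List.mem_ofFn.1 hv
    split_ifs <;> simp [Val.bits, bitLength]

theorem solvableInTime_of_pt {Q : GraphProblem} {μ : ℕ → ℕ} {f : Input → Val}
    (hf : PT encodeInput (fun x => μ x.1) f) (hQ : ∀ x : Input, Q x.1 x.2 (f x)) :
    ∃ c : ℕ, SolvableInTime Q fun n => ((μ n + 2 : ℕ) : ℝ) ^ c := by
  obtain ⟨⟨p, T, ⟨c, hc⟩, hp⟩, -⟩ := hf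
  refine ⟨c, p, fun n G => ?_⟩
  obtain ⟨s', t, hr, h0, ht⟩ := hp ⟨n, G⟩ (initStore (encodeGraph G)) (by simp [initStore])
  exact ⟨s', t, hr, h0 ▸ hQ ⟨n, G⟩, by
    have := ht.trans (hc ⟨n, G⟩)
    dsimp only at this ⊢
    exact_mod_cast this⟩

/-- The number of vertices of the gadget graphs for `n`-vertex graphs. -/
def gadgetSize (l n : ℕ) : ℕ := n * ((Nat.size n + 1) * (l + 3))

/-- The values of the independent set polynomial are computable, given a program for the values
at `x₀`: the polynomial is interpolated from its values at the weights of `n + 1` gadgets, and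
these are values at `x₀` of the independent set polynomials of the gadget graphs. -/
theorem pt_homogeneous_value {x₀ : ℚ} {T : ℕ → ℝ} (h : SolvableInTime (evaluation x₀) T) {l : ℕ}
    (hl : ∀ (M : ℕ) (b b' : ℕ → Bool), (rootWeights l x₀ M b).1 ≠ 0 ∧
      ((∃ t < M, b t ≠ b' t) → (rootWeights l x₀ M b).2 * (rootWeights l x₀ M b').1 -
        (rootWeights l x₀ M b).1 * (rootWeights l x₀ M b').2 ≠ 0))
    {μ : Input → ℕ} (hμ : PolyBdd μ fun x => x.1)
    (hT : PolyBdd μ fun x => ⌈T (gadgetSize l x.1)⌉₊) {r s : Input → ℤ}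
    (hr : PT encodeInput μ fun x => .int (r x)) (hs : PT encodeInput μ fun x => .int (s x))
    (hs0 : ∀ x, s x ≠ 0) :
    ∃ p q : Input → ℤ, (PT encodeInput μ fun x => .int (p x)) ∧
      (PT encodeInput μ fun x => .int (q x)) ∧ ∀ x, q x ≠ 0 ∧ (p x : ℚ) / q x =
        (s x : ℚ) ^ x.1 * Polynomial.aeval ((r x : ℚ) / s x) (indepPoly x.2) := by
  obtain ⟨F, hF, hPT⟩ := PT.oracle h
  set M : Input → ℕ := fun x => Nat.size x.1 + 1 with hM
  set k : Input → ℕ := fun x => x.1 + 1 with hk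
  set b : Input → ℕ → Val := fun x i => F _ (gadgetGraph x.2 l (M x) i.testBit) with hb
  set w : Input → ℕ → ℤ × ℤ := fun x i => intWeights l x₀.num x₀.den (M x) i.testBit with hw
  -- Preliminaries on the input.
  have he := pt_encodeInput hμ
  have hn : PT encodeInput μ fun x => .int (x.1 : ℕ) := he.nat_of_encodeGraph
  have hMp : PT encodeInput μ fun x => .int (M x : ℕ) :=
    (he.size hn hμ).natAdd (b := fun _ => 1) (PT.const 1)
  have hMb : PolyBdd μ M := (hμ.add (.const 2)).mono fun x => by
    have : Nat.size x.1 ≤ x.1 := Nat.size_le.2 Nat.lt_two_pow_self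
    simp only [hM]; omega
  have hkp : PT encodeInput μ fun x => .int (k x : ℕ) := hn.natAdd (b := fun _ => 1) (PT.const 1)
  have hkb : PolyBdd μ k := hμ.add (.const 1)
  have he1 := PT.ext_self he hkb
  have hkb1 := hkb.comap (Sigma.fst : (Σ x, Fin (k x)) → Input)
  have hi := PT.index he hkb
  -- The values of the gadget graphs.
  have hgad := pt_gadgetGraph (l := l) (n := fun y : Σ x, Fin (k x) => y.1.1)
    (G := fun y => y.1.2) (M := fun y => M y.1) (i := fun y => (y.2 : ℕ)) he1
    (PT.weaken he hkb he) (hμ.comap Sigma.fst) hi (PT.weaken he hkb hMp) (hMb.comap Sigma.fst)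
  have hbp : PT (ext encodeInput k) (fun y => μ y.1) fun y => b y.1 y.2 :=
    hPT hgad (hT.comap Sigma.fst)
  choose num den hnd hden hval using fun (x : Input) (i : ℕ) =>
    hF _ (gadgetGraph x.2 l (M x) i.testBit)
  have hnum' : PT (ext encodeInput k) (fun y => μ y.1) fun y => .int (num y.1 y.2) :=
    hbp.fst.congr fun y => by simp only [hb, hnd, Val.fst]
  have hden' : PT (ext encodeInput k) (fun y => μ y.1) fun y => .int (den y.1 y.2) :=
    hbp.snd.congr fun y => by simp only [hb, hnd, Val.snd]
  -- The weights of the gadgets.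
  have hwp := pt_intWeights (l := l) (α := x₀.num) (β := x₀.den)
    (M := fun y : Σ x, Fin (k x) => M y.1) (i := fun y => (y.2 : ℕ)) he1 hi
    (PT.weaken he hkb hMp) (hMb.comap Sigma.fst)
  have hQ : PT (ext encodeInput k) (fun y => μ y.1) fun y => .int (w y.1 y.2).1 := hwp.fst
  have hP : PT (ext encodeInput k) (fun y => μ y.1) fun y => .int (w y.1 y.2).2 := hwp.snd
  have out : ∀ {f : Input → ℕ → ℤ}, (PT (ext encodeInput k) (fun y => μ y.1)
      fun y => .int (f y.1 y.2)) → PT (ext (ext encodeInput k) fun y => k y.1) (fun z => μ z.1.1)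
      fun z => .int (f z.1.1 z.1.2) := fun hf => PT.weaken he1 hkb1 hf
  have inn : ∀ {f : Input → ℕ → ℤ}, (PT (ext encodeInput k) (fun y => μ y.1)
      fun y => .int (f y.1 y.2)) → PT (ext (ext encodeInput k) fun y => k y.1) (fun z => μ z.1.1)
      fun z => .int (f z.1.1 z.2) := fun hf => PT.inner he hkb hf
  have hr2 := PT.weaken he1 hkb1 (PT.weaken he hkb hr)
  have hs2 := PT.weaken he1 hkb1 (PT.weaken he hkb hs)
  have hN : PT (ext encodeInput k) (fun y => μ y.1)
      fun y => .int ((x₀.den : ℤ) ^ ((l + 3) * M y.1 * y.1.1)) :=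
    PT.weaken (f := fun x => .int ((x₀.den : ℤ) ^ ((l + 3) * M x * x.1))) he hkb
      (PT.pow he (PT.const x₀.den) (((PT.const ((l + 3 : ℕ) : ℤ)).natMul hMp).natMul hn)
        (((PolyBdd.const (l + 3)).mul hMb).mul hμ))
  have hnumer := (hN.mul hnum').mul (PT.prod_except
    (f := fun x _ j => r x * (w x j).1 - s x * (w x j).2) he hkp hkb
    ((hr2.mul (inn (f := fun x i => (w x i).1) hQ)).sub
      (hs2.mul (inn (f := fun x i => (w x i).2) hP))))
  have hdenom := hden'.mul (PT.prod_except
    (f := fun x i j => (w x i).2 * (w x j).1 - (w x i).1 * (w x j).2) he hkp hkb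
    (((out (f := fun x i => (w x i).2) hP).mul (inn (f := fun x i => (w x i).1) hQ)).sub
      ((out (f := fun x i => (w x i).1) hQ).mul (inn (f := fun x i => (w x i).2) hP))))
  -- The facts that make the interpolation possible.
  have hβ : (x₀.den : ℚ) ≠ 0 := by exact_mod_cast x₀.den_ne_zero
  have hwQ : ∀ x i, ((w x i).1 : ℚ) = (x₀.den : ℚ) ^ ((l + 3) * M x) *
      (rootWeights l x₀ (M x) i.testBit).1 := fun x i => (intWeights_eq l x₀ _ _).1
  have hwP : ∀ x i, ((w x i).2 : ℚ) = (x₀.den : ℚ) ^ ((l + 3) * M x) *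
      (rootWeights l x₀ (M x) i.testBit).2 := fun x i => (intWeights_eq l x₀ _ _).2
  have hQ0 : ∀ x i, ((w x i).1 : ℚ) ≠ 0 := fun x i => by
    rw [hwQ]; exact mul_ne_zero (pow_ne_zero _ hβ) (hl _ _ i.testBit).1
  have hcross : ∀ x, ∀ i ∈ Finset.range (x.1 + 1), ∀ j ∈ Finset.range (x.1 + 1), j ≠ i →
      ((w x i).2 : ℚ) * (w x j).1 - (w x i).1 * (w x j).2 ≠ 0 := by
    intro x i hi j hj hne
    rw [hwQ, hwQ, hwP, hwP]
    -- The indices have at most `M x` binary digits, so these digits distinguish them.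
    have hlt : ∀ m ∈ Finset.range (x.1 + 1), m < 2 ^ M x := fun m hm => by
      have h1 := Nat.lt_size_self x.1
      have h2 := Finset.mem_range.1 hm
      simp only [hM, pow_succ]; omega
    have hbit : ∃ t < M x, i.testBit t ≠ j.testBit t := by
      by_contra! hcon
      refine hne (Nat.eq_of_testBit_eq fun t => ?_).symm
      rcases lt_or_ge t (M x) with ht | ht
      · exact hcon t ht
      · rw [Nat.testBit_lt_two_pow ((hlt i hi).trans_le (Nat.pow_le_pow_right two_pos ht)),
          Nat.testBit_lt_two_pow ((hlt j hj).trans_le (Nat.pow_le_pow_right two_pos ht))]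
    have := mul_ne_zero (mul_ne_zero (pow_ne_zero ((l + 3) * M x) hβ)
      (pow_ne_zero ((l + 3) * M x) hβ)) ((hl (M x) i.testBit j.testBit).2 hbit)
    convert this using 1
    ring
  have hvalue : ∀ x i, (x₀.den : ℚ) ^ ((l + 3) * M x * x.1) * num x i / den x i =
      ((w x i).1 : ℚ) ^ x.1 * Polynomial.aeval (((w x i).2 : ℚ) / (w x i).1) (indepPoly x.2) := by
    intro x i
    have hg := aeval_gadgetGraph x.2 l (Nat.size x.1) i.testBit x₀ (hl _ _ i.testBit).1
    rw [mul_div_assoc, hval, hg, hwP, hwQ, mul_pow, mul_div_mul_left _ _ (pow_ne_zero _ hβ),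
      ← pow_mul]
    ring
  obtain ⟨p, q, hp, hq, hpq⟩ := PT.sum_fractions
    (a := fun x i => (x₀.den : ℤ) ^ ((l + 3) * M x * x.1) * num x i *
      ∏ j ∈ Finset.range (k x), if j = i then 1 else r x * (w x j).1 - s x * (w x j).2)
    (b := fun x i => den x i * ∏ j ∈ Finset.range (k x),
      if j = i then 1 else (w x i).2 * (w x j).1 - (w x i).1 * (w x j).2)
    he hkp hkb hnumer hdenom (fun x i hi => mul_ne_zero (hden x i).ne'
      (Finset.prod_ne_zero_iff.2 fun j hj => by
        split_ifs with hji
        · exact one_ne_zero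
        · exact_mod_cast hcross x i hi j hj hji))
  refine ⟨p, q, hp, hq, fun x => ⟨(hpq x).1, ?_⟩⟩
  rw [(hpq x).2, homogeneous_lagrange (natDegree_indepPoly_le x.2) (hQ0 x) (hcross x)
    (by exact_mod_cast hs0 x)]
  refine Finset.sum_congr rfl fun i _ => ?_
  rw [← hvalue]
  push_cast
  rw [mul_div_mul_comm, ← Finset.prod_div_distrib]
  congr 1
  refine Finset.prod_congr rfl fun j _ => ?_
  split_ifs <;> simp

/-- The time bound of the reduction, up to a polynomial. -/
noncomputable def reductionBound (l : ℕ) (T : ℕ → ℝ) (n : ℕ) : ℕ := n + ⌈T (gadgetSize l n)⌉₊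

/-- A program for the values at `x₀` yields programs for the coefficients and for all other values,
with polynomially related time bounds. -/
theorem exists_reduction {x₀ : ℚ} (hx : x₀ ≠ 0) (hx1 : -1 < x₀) : ∃ l : ℕ, ∀ T : ℕ → ℝ,
    SolvableInTime (evaluation x₀) T →
      (∃ c : ℕ, SolvableInTime coefficients fun n => ((reductionBound l T n + 2 : ℕ) : ℝ) ^ c) ∧
      ∀ x₁ : ℚ, ∃ c : ℕ,
        SolvableInTime (evaluation x₁) fun n => ((reductionBound l T n + 2 : ℕ) : ℝ) ^ c := by
  obtain ⟨l, hl⟩ := exists_leaves hx hx1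
  refine ⟨l, fun T h => ?_⟩
  set μ : Input → ℕ := fun x => reductionBound l T x.1 with hμdef
  have hμ : PolyBdd μ fun x => x.1 := PolyBdd.self.mono fun x => Nat.le_add_right _ _
  have hT : PolyBdd μ fun x => ⌈T (gadgetSize l x.1)⌉₊ :=
    PolyBdd.self.mono fun x => Nat.le_add_left _ _
  have he := pt_encodeInput hμ
  have hn : PT encodeInput μ fun x => .int (x.1 : ℕ) := he.nat_of_encodeGraph
  have hn1 : PT encodeInput μ fun x => .int ((x.1 + 1 : ℕ) : ℤ) :=
    hn.natAdd (b := fun _ => 1) (PT.const 1)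
  have hn1b : PolyBdd μ fun x => x.1 + 1 := hμ.add (.const 1)
  constructor
  · -- The value at `2 ^ (n + 1)` exhibits the coefficients as its digits.
    have hZ : PT encodeInput μ fun x => .int (2 ^ (x.1 + 1)) := PT.pow he (PT.const 2) hn1 hn1b
    obtain ⟨p, q, hp, hq, hpq⟩ := pt_homogeneous_value h hl hμ hT hZ (PT.const 1)
      fun _ => one_ne_zero
    have hW : ∀ x : Input, p x / q x = (indepPoly x.2).eval (2 ^ (x.1 + 1)) := fun x => by
      obtain ⟨hq0, hx⟩ := hpq x
      have hev : Polynomial.aeval (((2 ^ (x.1 + 1) : ℤ) : ℚ)) (indepPoly x.2) =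
          (((indepPoly x.2).eval (2 ^ (x.1 + 1)) : ℤ) : ℚ) := by
        rw [Polynomial.aeval_def, Polynomial.eval₂_at_intCast]; simp
      rw [Int.cast_one, one_pow, one_mul, div_one, hev, div_eq_iff (by exact_mod_cast hq0)] at hx
      exact Int.ediv_eq_of_eq_mul_left hq0 (by exact_mod_cast hx)
    have hdigit := PT.tabulate he hn1 hn1b ((((PT.weaken he hn1b hp).div (PT.weaken he hn1b hq)).div
      (PT.pow (PT.ext_self he hn1b) (PT.weaken he hn1b hZ) (PT.index he hn1b)
        ((hn1b.comap Sigma.fst).mono fun y => y.2.2.le))).mod (PT.weaken he hn1b hZ))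
    refine solvableInTime_of_pt (Q := coefficients) hdigit fun x => ?_
    simp only [coefficients]
    congr 2
    funext j
    rw [hW, eval_ediv_emod _ fun k => ⟨(coeff_indepPoly x.2 k).1,
      (coeff_indepPoly x.2 k).2.trans_lt (pow_lt_pow_right₀ one_lt_two (Nat.lt_succ_self _))⟩]
  · intro x₁
    obtain ⟨p, q, hp, hq, hpq⟩ := pt_homogeneous_value h hl hμ hT (PT.const x₁.num)
      (PT.const x₁.den) fun _ => by exact_mod_cast x₁.den_ne_zero
    have hq' := hq.mul (PT.pow he (PT.const x₁.den) hn hμ)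
    -- The denominator may be negative; multiplication by it makes the denominator a square.
    refine solvableInTime_of_pt (Q := evaluation x₁) ((hp.mul hq').pair (hq'.mul hq')) fun x => ?_
    obtain ⟨hq0, hx⟩ := hpq x
    have hd0 : (x₁.den : ℤ) ≠ 0 := by exact_mod_cast x₁.den_ne_zero
    have hne : q x * (x₁.den : ℤ) ^ x.1 ≠ 0 := mul_ne_zero hq0 (pow_ne_zero _ hd0)
    refine ⟨_, _, rfl, mul_self_pos.2 hne, ?_⟩
    have hne' : (q x : ℚ) * (x₁.den : ℚ) ^ x.1 ≠ 0 := by exact_mod_cast hne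
    have hd' : (x₁.den : ℚ) ^ x.1 ≠ 0 := (mul_ne_zero_iff.1 hne').2
    push_cast at hx ⊢
    rw [Rat.num_div_den] at hx
    rw [mul_div_mul_right _ _ hne', ← div_div, hx, mul_div_cancel_left₀ _ hd']

end IndepSetPoly

namespace IndepSetPoly

open Filter Asymptotics

/-! ### Growth of the time bounds -/

theorem SolvableInTime.mono {Q : GraphProblem} {T T' : ℕ → ℝ} (h : SolvableInTime Q T)
    (hT : ∀ n, T n ≤ T' n) : SolvableInTime Q T' := by
  obtain ⟨p, hp⟩ := h
  refine ⟨p, fun n G => ?_⟩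
  obtain ⟨s, t, hr, hQ, ht⟩ := hp n G
  exact ⟨s, t, hr, hQ, ht.trans (hT n)⟩

theorem size_add_one_le {n : ℕ} (hn : 1 ≤ Real.log n) :
    ((Nat.size n + 1 : ℕ) : ℝ) ≤ 4 * Real.log n := by
  have hn0 : 0 < n := by
    rcases Nat.eq_zero_or_pos n with rfl | h
    · norm_num at hn
    · exact h
  obtain ⟨k, hk⟩ : ∃ k, Nat.size n = k + 1 :=
    ⟨Nat.size n - 1, (Nat.sub_add_cancel (Nat.size_pos.2 hn0)).symm⟩
  have h1 : 2 ^ k ≤ n := Nat.lt_size.1 (by omega)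
  have h2 : (k : ℝ) * Real.log 2 ≤ Real.log n := by
    rw [← Real.log_pow]
    exact Real.log_le_log (by positivity) (by exact_mod_cast h1)
  have h3 := Real.log_two_gt_d9
  have h4 : (0 : ℝ) ≤ k := Nat.cast_nonneg k
  rw [hk]
  push_cast
  nlinarith

theorem le_gadgetSize (l n : ℕ) : n ≤ gadgetSize l n :=
  Nat.le_mul_of_pos_right n (by positivity)

/-- The gadget graphs have `O(n log n)` vertices, so that `N / log ^ 3 N` is `O(n / log ^ 2 n)`. -/
theorem eventually_gadgetSize_le (l : ℕ) {δ : ℝ} (hδ : 0 < δ) : ∀ᶠ n : ℕ in atTop,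
    (gadgetSize l n : ℝ) / Real.log (gadgetSize l n) ^ 3 ≤ δ * n := by
  have hlog : Tendsto (fun n : ℕ => Real.log n) atTop atTop :=
    Real.tendsto_log_atTop.comp tendsto_natCast_atTop_atTop
  filter_upwards [hlog.eventually_ge_atTop 1, hlog.eventually_ge_atTop (4 * (l + 3) / δ),
    eventually_gt_atTop 0] with n h1 h2 hn
  have hL : Real.log n ≤ Real.log (gadgetSize l n) :=
    Real.log_le_log (by exact_mod_cast hn) (by exact_mod_cast le_gadgetSize l n)
  have hpos : 0 < Real.log n := by linarith
  have hn' : (0 : ℝ) < n := by exact_mod_cast hn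
  calc (gadgetSize l n : ℝ) / Real.log (gadgetSize l n) ^ 3
      ≤ (gadgetSize l n : ℝ) / Real.log n ^ 3 := by gcongr
    _ ≤ n * (4 * Real.log n * (l + 3)) / Real.log n ^ 3 := by
        have := size_add_one_le h1
        have he : (gadgetSize l n : ℝ) = n * (((Nat.size n + 1 : ℕ) : ℝ) * (l + 3)) := by
          simp [gadgetSize]
        rw [he]
        gcongr
    _ = n * (4 * (l + 3) / Real.log n ^ 2) := by field_simp
    _ ≤ n * δ := by
        gcongr
        rw [div_le_iff₀ hδ] at h2
        rw [div_le_iff₀ (by positivity)]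
        nlinarith
    _ = δ * n := mul_comm _ _

/-- If `T` grows at most like `2 ^ (N / log ^ 3 N)`, the time bound of the reduction is
subexponential. -/
theorem eventually_reductionBound_le (l : ℕ) {T : ℕ → ℝ} {C : ℝ}
    (hT : ∀ᶠ N : ℕ in atTop, T N ≤ C * (2 : ℝ) ^ ((N : ℝ) / Real.log N ^ 3)) {δ : ℝ} (hδ : 0 < δ) :
    ∀ᶠ n : ℕ in atTop, ((reductionBound l T n + 2 : ℕ) : ℝ) ≤ (2 : ℝ) ^ (δ * n) := by
  have hN : Tendsto (gadgetSize l) atTop atTop := tendsto_atTop_mono (le_gadgetSize l) tendsto_id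
  set D : ℝ := |C| + 3 with hD
  have hD0 : 0 < D + 1 := by positivity
  have hr : 1 < (2 : ℝ) ^ (δ / 2) := Real.one_lt_rpow one_lt_two (by positivity)
  have hlin := (tendsto_pow_const_div_const_pow_of_one_lt 1 hr).eventually_lt_const
    (show 0 < 1 / (D + 1) by positivity)
  filter_upwards [hN.eventually hT, eventually_gadgetSize_le l (half_pos hδ), hlin,
    eventually_ge_atTop 1] with n h1 h2 h3 hn
  have hn' : (1 : ℝ) ≤ n := by exact_mod_cast hn
  have hE : (2 : ℝ) ^ (δ / 2 * n) = ((2 : ℝ) ^ (δ / 2)) ^ n := by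
    rw [Real.rpow_mul zero_le_two, Real.rpow_natCast]
  have hpoly : (n : ℝ) + D ≤ (2 : ℝ) ^ (δ / 2 * n) := by
    rw [pow_one, div_lt_div_iff₀ (by positivity) hD0, one_mul, ← hE] at h3
    nlinarith [mul_nonneg (show 0 ≤ D by positivity) (sub_nonneg.2 hn')]
  have hone : (1 : ℝ) ≤ (2 : ℝ) ^ (δ / 2 * n) := Real.one_le_rpow one_le_two (by positivity)
  have hTn : T (gadgetSize l n) ≤ |C| * (2 : ℝ) ^ (δ / 2 * n) :=
    h1.trans (mul_le_mul (le_abs_self C) (Real.rpow_le_rpow_of_exponent_le one_le_two h2)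
      (by positivity) (abs_nonneg C))
  have hceil : (⌈T (gadgetSize l n)⌉₊ : ℝ) ≤ |C| * (2 : ℝ) ^ (δ / 2 * n) + 1 := by
    refine (Nat.cast_le.2 (Nat.ceil_mono hTn)).trans (Nat.ceil_lt_add_one (by positivity)).le
  have hsplit : (2 : ℝ) ^ (δ * n) = (2 : ℝ) ^ (δ / 2 * n) * (2 : ℝ) ^ (δ / 2 * n) := by
    rw [← Real.rpow_add two_pos]; congr 1; ring
  rw [hsplit]
  simp only [reductionBound]
  push_cast
  nlinarith

theorem solvableInTwoPowLittleO_of_eventually {Q : GraphProblem} {B : ℕ → ℕ} {c : ℕ}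
    (hB0 : ∀ n, 1 ≤ B n) (h : SolvableInTime Q fun n => (B n : ℝ) ^ c)
    (hB : ∀ δ : ℝ, 0 < δ → ∀ᶠ n : ℕ in atTop, (B n : ℝ) ≤ (2 : ℝ) ^ (δ * n)) :
    SolvableInTwoPowLittleO Q fun n => (n : ℝ) := by
  have hpos : ∀ n, (0 : ℝ) < B n := fun n => by exact_mod_cast hB0 n
  refine ⟨fun n => c * Real.logb 2 (B n), ?_, h.mono fun n => ?_⟩
  · refine isLittleO_iff.2 fun ε hε => ?_
    filter_upwards [hB (ε / (c + 1)) (by positivity)] with n hn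
    have h0 : 0 ≤ Real.logb 2 (B n) :=
      Real.logb_nonneg one_lt_two (by exact_mod_cast hB0 n)
    have h1 : Real.logb 2 (B n) ≤ ε / (c + 1) * n := by
      rwa [Real.logb_le_iff_le_rpow one_lt_two (hpos n)]
    rw [Real.norm_of_nonneg (by positivity), Real.norm_of_nonneg (by positivity)]
    calc c * Real.logb 2 (B n) ≤ (c + 1) * (ε / (c + 1) * n) := by
          gcongr
          linarith
      _ = ε * n := by field_simp
  · dsimp only
    rw [mul_comm, Real.rpow_mul zero_le_two, Real.rpow_logb two_pos (by norm_num) (hpos n),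
      Real.rpow_natCast]

theorem solvableInTwoPowEveryRate_of_eventually {Q : GraphProblem} {B : ℕ → ℕ} {c : ℕ}
    (h : SolvableInTime Q fun n => (B n : ℝ) ^ c)
    (hB : ∀ δ : ℝ, 0 < δ → ∀ᶠ n : ℕ in atTop, (B n : ℝ) ≤ (2 : ℝ) ^ (δ * n)) :
    SolvableInTwoPowEveryRate Q fun n => (n : ℝ) := by
  intro r hr
  obtain ⟨n₀, hn₀⟩ := eventually_atTop.1 (hB (r / (c + 1)) (by positivity))
  refine ⟨1 + ∑ n ∈ Finset.range n₀, (B n : ℝ) ^ c, h.mono fun n => ?_⟩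
  have hone : (1 : ℝ) ≤ (2 : ℝ) ^ (r * n) := Real.one_le_rpow one_le_two (by positivity)
  have hsum : 0 ≤ ∑ n ∈ Finset.range n₀, (B n : ℝ) ^ c := by positivity
  rcases lt_or_ge n n₀ with hn | hn
  · have := Finset.single_le_sum (f := fun n => (B n : ℝ) ^ c) (fun n _ => by positivity)
      (Finset.mem_range.2 hn)
    dsimp only at this ⊢
    nlinarith
  · calc (B n : ℝ) ^ c ≤ ((2 : ℝ) ^ (r / (c + 1) * n)) ^ c := by gcongr; exact hn₀ n hn
      _ = (2 : ℝ) ^ (r / (c + 1) * n * c) := (Real.rpow_mul_natCast zero_le_two _ c).symm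
      _ ≤ (2 : ℝ) ^ (r * n) := by
          refine Real.rpow_le_rpow_of_exponent_le one_le_two ?_
          rw [div_mul_eq_mul_div, div_mul_eq_mul_div, div_le_iff₀ (by positivity)]
          nlinarith [mul_nonneg hr.le (Nat.cast_nonneg (α := ℝ) n)]
      _ ≤ _ := by nlinarith

end IndepSetPoly

theorem mainTheorem4 (x₀ : ℚ) (hx₀ : IndepSetPoly.Nondegenerate (x₀ : ℝ)) :
    (IndepSetPoly.SolvableInTwoPowLittleO (IndepSetPoly.evaluation x₀)
        (fun n : ℕ => (n : ℝ) / Real.log (n : ℝ) ^ 3) →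
      IndepSetPoly.SolvableInTwoPowLittleO IndepSetPoly.coefficients (fun n : ℕ => (n : ℝ)) ∧
      ∀ x₁ : ℚ, IndepSetPoly.SolvableInTwoPowLittleO (IndepSetPoly.evaluation x₁)
        (fun n : ℕ => (n : ℝ))) ∧
    (IndepSetPoly.SolvableInTwoPowEveryRate (IndepSetPoly.evaluation x₀)
        (fun n : ℕ => (n : ℝ) / Real.log (n : ℝ) ^ 3) →
      IndepSetPoly.SolvableInTwoPowEveryRate IndepSetPoly.coefficients (fun n : ℕ => (n : ℝ)) ∧
      ∀ x₁ : ℚ, IndepSetPoly.SolvableInTwoPowEveryRate (IndepSetPoly.evaluation x₁)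
        (fun n : ℕ => (n : ℝ))) := by
  have hx : x₀ ≠ 0 := by exact_mod_cast hx₀.2
  have hx1 : -1 < x₀ := by
    have h : (-1 : ℝ) < x₀ := by linarith [hx₀.1]
    exact_mod_cast h
  obtain ⟨l, hl⟩ := IndepSetPoly.exists_reduction hx hx1
  constructor
  · rintro ⟨f, hf, hsolv⟩
    have hT : ∀ᶠ N : ℕ in Filter.atTop,
        (2 : ℝ) ^ f N ≤ 1 * (2 : ℝ) ^ ((N : ℝ) / Real.log N ^ 3) := by
      filter_upwards [hf.bound one_pos] with N hN
      have hlog : 0 ≤ Real.log (N : ℝ) := Real.log_natCast_nonneg N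
      have hg : 0 ≤ (N : ℝ) / Real.log N ^ 3 := by positivity
      rw [one_mul, Real.norm_of_nonneg hg, Real.norm_eq_abs] at hN
      rw [one_mul]
      exact Real.rpow_le_rpow_of_exponent_le one_le_two ((le_abs_self _).trans hN)
    have hB := fun δ (hδ : (0 : ℝ) < δ) => IndepSetPoly.eventually_reductionBound_le l hT hδ
    obtain ⟨⟨c, hc⟩, hev⟩ := hl _ hsolv
    refine ⟨IndepSetPoly.solvableInTwoPowLittleO_of_eventually (fun n => by omega) hc hB,
      fun x₁ => ?_⟩
    obtain ⟨c, hc⟩ := hev x₁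
    exact IndepSetPoly.solvableInTwoPowLittleO_of_eventually (fun n => by omega) hc hB
  · intro h
    -- Since `N / log ^ 3 N` is `o(n)` for the gadget graphs, the rate `1` suffices for all rates.
    obtain ⟨C, hsolv⟩ := h 1 one_pos
    have hT : ∀ᶠ N : ℕ in Filter.atTop, C * (2 : ℝ) ^ (1 * ((N : ℝ) / Real.log N ^ 3)) ≤
        C * (2 : ℝ) ^ ((N : ℝ) / Real.log N ^ 3) :=
      Filter.Eventually.of_forall fun N => by rw [one_mul]
    have hB := fun δ (hδ : (0 : ℝ) < δ) => IndepSetPoly.eventually_reductionBound_le l hT hδ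
    obtain ⟨⟨c, hc⟩, hev⟩ := hl _ hsolv
    refine ⟨IndepSetPoly.solvableInTwoPowEveryRate_of_eventually hc hB, fun x₁ => ?_⟩
    obtain ⟨c, hc⟩ := hev x₁
    exact IndepSetPoly.solvableInTwoPowEveryRate_of_eventually hc hB
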